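/- Let $m\ge 3$ and let $\alpha=(\alpha_1,\dots,\alpha_m)$ be integers with $\alpha_i\ge 2$ for all $i$. We identify $\alpha$ with the ribbon whose rows, from top to bottom, have lengths $\alpha_1,\dots,\alpha_m$, that is, the connected skew shape containing no $2\times 2$ block with these row lengths. For a skew shape $\lambda/\mu$, write the skew Schur function as $s_{\lambda/\mu}=\sum_\nu c^{\lambda}_{\mu,\nu}s_\nu$, where $\nu$ runs over the partitions, and let $[\lambda/\mu]=\{\nu : c^{\lambda}_{\mu,\nu}>0\}$ be its Schur support. For a permutation $\pi\in S_m$ let $\alpha_\pi=(\alpha_{\pi^{-1}(1)},\dots,\alpha_{\pi^{-1}(m)})$. Suppose that the lengths of any three rows of $\alpha$ satisfy the strict triangle inequality: whenever $i,j,k$ are pairwise distinct indices with $\alpha_i\le\alpha_j\le\alpha_k$, we have $\alpha_k<\alpha_i+\alpha_j$. Then $\alpha$ has full equivalence class, that is, $[\alpha]=[\alpha_\pi]$ for every permutation $\pi\in S_m$. -/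

import Mathlib

/-- A skew shape `outer / inner`, where the Young diagram `inner` is contained in `outer`.
Rows are numbered from the top, columns from the left, both starting at `0`. -/
structure SkewShape where
  outer : YoungDiagram
  inner : YoungDiagram
  inner_le : inner ≤ outer

namespace SkewShape

/-- The boxes of a skew shape. -/
def cells (s : SkewShape) : Finset (ℕ × ℕ) :=
  s.outer.cells \ s.inner.cells

end SkewShape

/-- A semistandard filling of a skew shape: the entries increase weakly along rows and strictly
down columns. As in Mathlib's `SemistandardYoungTableau`, entries are natural numbers
(the alphabet starts at `0` instead of `1`) and positions outside the shape carry the value `0`. -/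
structure SkewSSYT (s : SkewShape) where
  entry : ℕ → ℕ → ℕ
  row_weak : ∀ {i j₁ j₂ : ℕ}, j₁ < j₂ → (i, j₁) ∈ s.cells → (i, j₂) ∈ s.cells →
    entry i j₁ ≤ entry i j₂
  col_strict : ∀ {i₁ i₂ j : ℕ}, i₁ < i₂ → (i₁, j) ∈ s.cells → (i₂, j) ∈ s.cells →
    entry i₁ j < entry i₂ j
  zeros : ∀ {i j : ℕ}, (i, j) ∉ s.cells → entry i j = 0

/-- The content of a skew tableau: `T.content k` is the number of boxes with entry `k`. -/
noncomputable def SkewSSYT.content {s : SkewShape} (T : SkewSSYT s) : ℕ →₀ ℕ :=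
  ∑ c ∈ s.cells, Finsupp.single (T.entry c.1 c.2) 1

/-- The content of a tableau of straight shape. -/
noncomputable def SemistandardYoungTableau.content {ν : YoungDiagram}
    (T : SemistandardYoungTableau ν) : ℕ →₀ ℕ :=
  ∑ c ∈ ν.cells, Finsupp.single (T c.1 c.2) 1

/-- The Schur function `s_ν = ∑ x^T`, the sum being over the semistandard tableaux `T` of shape
`ν`, as a formal power series in the variables `x₀, x₁, x₂, …`: the coefficient of `x^d` is the
(finite) number of semistandard tableaux of shape `ν` and content `d`. -/
noncomputable def schurFunction (ν : YoungDiagram) : MvPowerSeries ℕ ℤ :=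
  fun d => (Nat.card {T : SemistandardYoungTableau ν // T.content = d} : ℤ)

/-- The skew Schur function of a skew shape, defined in the same way. -/
noncomputable def skewSchurFunction (s : SkewShape) : MvPowerSeries ℕ ℤ :=
  fun d => (Nat.card {T : SkewSSYT s // T.content = d} : ℤ)

/-- `c` is the family of coefficients of the expansion of the skew Schur function of `s` as a
(finite) linear combination of Schur functions, that is, `c ν` is the coefficient of `s_ν`. -/
def IsSchurExpansion (s : SkewShape) (c : YoungDiagram →₀ ℤ) : Prop :=
  skewSchurFunction s = c.sum fun ν a => a • schurFunction ν

/-- The Schur support of a skew shape: the set of straight shapes whose Schur function has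
positive coefficient in the expansion of the skew Schur function. -/
def schurSupport (s : SkewShape) : Set YoungDiagram :=
  {ν | ∃ c : YoungDiagram →₀ ℤ, IsSchurExpansion s c ∧ 0 < c ν}

/-- The Young diagram with `m` rows of lengths `f 0 ≥ f 1 ≥ ⋯ ≥ f (m - 1)`
(rows of length zero are allowed). -/
def youngDiagramOfAntitone {m : ℕ} (f : Fin m → ℕ) (hf : Antitone f) : YoungDiagram :=
  YoungDiagram.ofRowLens (List.ofFn f) hf.sortedGE_ofFn

/-- The ribbon whose rows have lengths `α 0, α 1, …, α (m - 1)` from top to bottom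
(all positive). Consecutive rows overlap in exactly one column: the leftmost box of row `i` is
directly above the rightmost box of row `i + 1`. The last row starts in column `0`, so that row `i`
starts in column `∑_{k > i} (α k - 1)` and ends in column `∑_{k ≥ i} (α k - 1)`. -/
def ribbon {m : ℕ} (α : Fin m → ℕ) : SkewShape where
  outer := youngDiagramOfAntitone (fun i => 1 + ∑ k ∈ Finset.Ici i, (α k - 1)) fun _ _ h =>
    Nat.add_le_add_left (Finset.sum_le_sum_of_subset (Finset.Ici_subset_Ici.2 h)) 1
  inner := youngDiagramOfAntitone (fun i => ∑ k ∈ Finset.Ioi i, (α k - 1)) fun _ _ h =>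
    Finset.sum_le_sum_of_subset (Finset.Ioi_subset_Ioi h)
  inner_le := by
    rintro ⟨i, j⟩ h
    simp only [youngDiagramOfAntitone, YoungDiagram.mem_ofRowLens,
      List.getElem_ofFn, List.length_ofFn] at h ⊢
    obtain ⟨hi, hj⟩ := h
    exact ⟨hi, hj.trans_le ((Finset.sum_le_sum_of_subset Finset.Ioi_subset_Ici_self).trans
      (Nat.le_add_left _ _))⟩

/-- The row lengths `α_π = (α_{π⁻¹(1)}, …, α_{π⁻¹(m)})`. -/
def permuteRows {m : ℕ} (α : Fin m → ℕ) (π : Equiv.Perm (Fin m)) : Fin m → ℕ :=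
  fun i => α (π⁻¹ i)

/-- The ribbon with row lengths `α` has full equivalence class: `[α] = [α_π]` for every
permutation `π` of the row indices. -/
def HasFullEquivalenceClass {m : ℕ} (α : Fin m → ℕ) : Prop :=
  ∀ π : Equiv.Perm (Fin m), schurSupport (ribbon α) = schurSupport (ribbon (permuteRows α π))

/-! The Schur support of such a ribbon is described by conditions in which only the multiset of row
lengths occurs (`Admissible`), so permuting the rows cannot change it. The conditions on ν are: the
right number of boxes n; at most n - m + 1 boxes in row 0; and, for every k, at most as many boxes
from row k on as any m - k of the row lengths add up to.

The coefficient of s_ν is made combinatorial first. Reading a filling of the ribbon row by row from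
the bottom gives a word with prescribed descents, and cutting such words yields h_a · r_(b,β) =
r_(a,b,β) + r_(a+b,β) (`wordSeries_ribbonDescents`). Together with the Pieri rule
(`completeSymmetric_mul_schurFunction`) this shows that the coefficient counts chains of horizontal
strips from ⊥ to ν, with the row lengths as strip sizes and a descent between consecutive strips
(`ribbonCoeff`, `wordSeries_eq_sum`). Schur functions are linearly independent, so the support is
where this count is positive.

Necessity of the conditions needs no triangle inequality: horizontal strips bound the tails, and
each descent forces a new box below row 0 (`admissible_of_descentChains_pos`). Sufficiency is
`exists_descentChains_pos`. A chain is built backwards by removing from ν the lowest possible strip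
that leaves an admissible diagram. A strip that meets the last row is preceded by a descent as soon
as the strip before it meets a higher row. The induction therefore also proves that, under mild
conditions on the last two rows, the final strip can be made to meet a higher row, if necessary by
moving one of its boxes up by a row. The triangle inequality ensures that these strips exist, that
they preserve admissibility, and that the mild conditions hold when they are needed. -/

namespace YoungDiagram

/-! ### Row lengths and tails of Young diagrams -/

theorem ext_rowLen {μ ν : YoungDiagram} (h : ∀ i, μ.rowLen i = ν.rowLen i) : μ = ν := by
  apply SetLike.ext
  rintro ⟨i, j⟩
  rw [mem_iff_lt_rowLen, mem_iff_lt_rowLen, h]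

theorem exists_rowLen_eq {f : ℕ → ℕ} (hf : Antitone f) {n : ℕ} (hn : f n = 0) :
    ∃ ν : YoungDiagram, ∀ i, ν.rowLen i = f i := by
  refine ⟨⟨(Finset.range n ×ˢ Finset.range (f 0)).filter fun c => c.2 < f c.1, ?_⟩, ?_⟩
  · rintro ⟨i, j⟩ ⟨i', j'⟩ ⟨h1, h2⟩ h
    simp only [Finset.coe_filter, Finset.mem_product, Finset.mem_range, Set.mem_ofPred_eq] at h ⊢
    simp only at h1 h2
    have := hf h1
    omega
  · intro i
    apply eq_of_forall_lt_iff
    intro j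
    rw [← mem_iff_lt_rowLen, ← mem_cells]
    simp only [Finset.mem_filter, Finset.mem_product, Finset.mem_range]
    constructor
    · exact fun h => h.2
    · intro h
      have h1 := hf (Nat.zero_le i)
      refine ⟨⟨?_, by omega⟩, h⟩
      by_contra h2
      have := hf (not_lt.1 h2)
      omega

theorem rowLen_eq_zero {ν : YoungDiagram} {k : ℕ} (h : ν.card ≤ k) : ν.rowLen k = 0 := by
  by_contra h0
  have h1 : (k, 0) ∈ ν := mem_iff_lt_rowLen.2 (Nat.pos_of_ne_zero h0)
  have h2 := mem_iff_lt_colLen.1 h1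
  have h3 : ν.colLen 0 ≤ ν.card := by
    rw [colLen_eq_card]
    exact Finset.card_le_card (Finset.filter_subset _ _)
  omega

/-- The number of boxes in the rows numbered `k` and higher. -/
def tail (ν : YoungDiagram) (k : ℕ) : ℕ :=
  (ν.cells.filter fun c => k ≤ c.1).card

theorem tail_zero (ν : YoungDiagram) : ν.tail 0 = ν.card := by
  simp [tail]

theorem tail_succ (ν : YoungDiagram) (k : ℕ) : ν.tail k = ν.rowLen k + ν.tail (k + 1) := by
  rw [rowLen_eq_card, tail, tail, row, ← Finset.card_union_of_disjoint]
  · congr 1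
    ext c
    simp only [Finset.mem_filter, Finset.mem_union]
    constructor
    · rintro ⟨h1, h2⟩
      rcases h2.eq_or_lt with h | h
      · exact Or.inl ⟨h1, h.symm⟩
      · exact Or.inr ⟨h1, h⟩
    · rintro (⟨h1, h2⟩ | ⟨h1, h2⟩)
      · exact ⟨h1, h2.ge⟩
      · exact ⟨h1, by omega⟩
  · rw [Finset.disjoint_filter]
    intro c _ h1 h2
    omega

theorem tail_eq_zero {ν : YoungDiagram} {k : ℕ} (h : ν.rowLen k = 0) : ν.tail k = 0 := by
  rw [tail, Finset.card_eq_zero, Finset.filter_eq_empty_iff]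
  rintro ⟨i, j⟩ hc hk
  rw [mem_cells, mem_iff_lt_rowLen] at hc
  have := ν.rowLen_anti k i hk
  omega

/-- Downward induction from a row beyond which both sides vanish. It serves to compute the tails of
diagrams that are constructed from their row lengths. -/
theorem eq_tail {ν : YoungDiagram} {t : ℕ → ℕ} (ht : ∀ k, t k = ν.rowLen k + t (k + 1)) {M : ℕ}
    (hM : ∀ k, M ≤ k → t k = 0) (k : ℕ) : t k = ν.tail k := by
  have key : ∀ n k, M + ν.card ≤ k + n → t k = ν.tail k := by
    intro n
    induction n with
    | zero =>
      intro k hk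
      rw [hM k (by omega), tail_eq_zero (rowLen_eq_zero (by omega))]
    | succ n ih =>
      intro k hk
      rw [ht, tail_succ, ih (k + 1) (by omega)]
  exact key (M + ν.card) k (by omega)

theorem tail_eq_sum {ν : YoungDiagram} {M : ℕ} (hM : ν.card ≤ M) (k : ℕ) :
    ν.tail k = ∑ i ∈ Finset.range M, ν.rowLen (k + i) := by
  symm
  apply eq_tail (t := fun k => ∑ i ∈ Finset.range M, ν.rowLen (k + i)) (M := ν.card)
  · intro k
    have h := Finset.sum_range_succ' (fun i => ν.rowLen (k + i)) M
    rw [Finset.sum_range_succ, rowLen_eq_zero (k := k + M) (by omega)] at h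
    simp only [add_zero] at h
    rw [h, add_comm]
    simp only [add_comm, add_left_comm]
  · intro k hk
    exact Finset.sum_eq_zero fun i _ => rowLen_eq_zero (by omega)

theorem card_eq_sum {ν : YoungDiagram} {M : ℕ} (hM : ν.card ≤ M) :
    ν.card = ∑ i ∈ Finset.range M, ν.rowLen i := by
  rw [← tail_zero, tail_eq_sum hM]
  simp

theorem tail_le_of_rowLen_le {μ ν : YoungDiagram} {k l : ℕ}
    (h : ∀ i, ν.rowLen (k + i) ≤ μ.rowLen (l + i)) : ν.tail k ≤ μ.tail l := by
  rw [tail_eq_sum (le_max_left ν.card μ.card), tail_eq_sum (le_max_right ν.card μ.card)]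
  exact Finset.sum_le_sum fun i _ => h i

theorem rowLen_zero_add_tail_one (ν : YoungDiagram) : ν.rowLen 0 + ν.tail 1 = ν.card := by
  rw [← tail_zero, tail_succ ν 0]

/-! ### Horizontal strips -/

/-- `ν / μ` is a horizontal strip: `μ` is contained in `ν`, and the skew shape `ν / μ` has at most
one box in each column. -/
def IsHorizontalStrip (ν μ : YoungDiagram) : Prop :=
  ∀ i, μ.rowLen i ≤ ν.rowLen i ∧ ν.rowLen (i + 1) ≤ μ.rowLen i

theorem le_of_rowLen_le {μ ν : YoungDiagram} (h : ∀ i, μ.rowLen i ≤ ν.rowLen i) : μ ≤ ν := by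
  rintro ⟨i, j⟩ hc
  exact mem_iff_lt_rowLen.2 ((mem_iff_lt_rowLen.1 hc).trans_le (h i))

theorem rowLen_le_of_le {μ ν : YoungDiagram} (h : μ ≤ ν) (i : ℕ) : μ.rowLen i ≤ ν.rowLen i := by
  by_contra! hlt
  exact absurd (mem_iff_lt_rowLen.1 (h (mem_iff_lt_rowLen.2 hlt))) (lt_irrefl _)

theorem IsHorizontalStrip.le {μ ν : YoungDiagram} (h : IsHorizontalStrip ν μ) : μ ≤ ν :=
  le_of_rowLen_le fun i => (h i).1

theorem card_le_of_le {μ ν : YoungDiagram} (h : μ ≤ ν) : μ.card ≤ ν.card :=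
  Finset.card_le_card (cells_subset_iff.2 h)

theorem eq_of_le_of_card_eq {μ ν : YoungDiagram} (h : μ ≤ ν) (hc : μ.card = ν.card) : μ = ν := by
  apply SetLike.ext
  intro c
  rw [← mem_cells, ← mem_cells, Finset.eq_of_subset_of_card_le (cells_subset_iff.2 h) hc.ge]

theorem finite_Iic (ν : YoungDiagram) : {μ : YoungDiagram | μ ≤ ν}.Finite := by
  apply Set.Finite.of_finite_image (f := cells)
  · exact (Finset.finite_toSet ν.cells.powerset).subset fun s ⟨μ, hμ, h⟩ => by
      simpa [← h] using (cells_subset_iff.2 hμ)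
  · intro μ _ ν _ h
    apply SetLike.ext
    intro c
    rw [← mem_cells, ← mem_cells, h]

theorem finite_card_eq (N : ℕ) : {μ : YoungDiagram | μ.card = N}.Finite := by
  apply Set.Finite.of_finite_image (f := cells)
  · refine (Finset.finite_toSet (Finset.range N ×ˢ Finset.range N).powerset).subset ?_
    rintro s ⟨μ, hμ, h⟩
    simp only [Set.mem_ofPred_eq] at hμ
    simp only [← h, Finset.coe_powerset, Set.mem_preimage, Set.mem_powerset_iff,
      Finset.coe_subset]
    rintro ⟨i, j⟩ hc
    rw [mem_cells] at hc
    have h1 := mem_iff_lt_rowLen.1 hc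
    have h2 := μ.rowLen_anti 0 i (Nat.zero_le i)
    have h3 := μ.rowLen_zero_add_tail_one
    simp only [Finset.mem_product, Finset.mem_range]
    refine ⟨?_, by omega⟩
    by_contra h4
    have := rowLen_eq_zero (ν := μ) (k := i) (by omega)
    omega
  · intro μ _ ν _ h
    apply SetLike.ext
    intro c
    rw [← mem_cells, ← mem_cells, h]

/-- The diagrams with `N` boxes. -/
noncomputable def ofCard (N : ℕ) : Finset YoungDiagram :=
  (finite_card_eq N).toFinset

@[simp]
theorem mem_ofCard {N : ℕ} {μ : YoungDiagram} : μ ∈ ofCard N ↔ μ.card = N := by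
  simp [ofCard]

open Classical in
/-- The diagrams obtained from `ν` by removing a horizontal strip. -/
noncomputable def stripBelow (ν : YoungDiagram) : Finset YoungDiagram :=
  (finite_Iic ν).toFinset.filter fun μ => IsHorizontalStrip ν μ

@[simp]
theorem mem_stripBelow {μ ν : YoungDiagram} : μ ∈ stripBelow ν ↔ IsHorizontalStrip ν μ := by
  simp only [stripBelow, Finset.mem_filter, Set.Finite.mem_toFinset, Set.mem_ofPred_eq]
  exact ⟨fun h => h.2, fun h => ⟨h.le, h⟩⟩

/-- The diagrams obtained from `ν` by removing a horizontal strip with `a` boxes. -/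
noncomputable def removeStrip (ν : YoungDiagram) (a : ℕ) : Finset YoungDiagram :=
  (stripBelow ν).filter fun μ => μ.card + a = ν.card

@[simp]
theorem mem_removeStrip {μ ν : YoungDiagram} {a : ℕ} :
    μ ∈ removeStrip ν a ↔ IsHorizontalStrip ν μ ∧ μ.card + a = ν.card := by
  simp [removeStrip]

open Classical in
/-- The diagrams obtained from `μ` by adding a horizontal strip with `a` boxes. -/
noncomputable def addStrip (μ : YoungDiagram) (a : ℕ) : Finset YoungDiagram :=
  (ofCard (μ.card + a)).filter fun ν => IsHorizontalStrip ν μ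

@[simp]
theorem mem_addStrip {μ ν : YoungDiagram} {a : ℕ} :
    ν ∈ addStrip μ a ↔ IsHorizontalStrip ν μ ∧ ν.card = μ.card + a := by
  simp [addStrip, and_comm]

theorem sum_rowLen_add_tail (ν : YoungDiagram) (k : ℕ) :
    ∑ i ∈ Finset.range k, ν.rowLen i + ν.tail k = ν.card := by
  induction k with
  | zero => simp [tail_zero]
  | succ k ih => rw [Finset.sum_range_succ, add_assoc, ← tail_succ, ih]

/-- When the rows from k on account for fewer boxes than the whole difference, the rest must come
from above row k. This is how a strip is seen to meet a higher row. -/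
theorem exists_rowLen_ne {μ ν : YoungDiagram} {k : ℕ}
    (h : μ.card + ν.tail k < ν.card + μ.tail k) : ∃ i < k, μ.rowLen i ≠ ν.rowLen i := by
  by_contra! h0
  have h1 := sum_rowLen_add_tail μ k
  have h2 := sum_rowLen_add_tail ν k
  have h3 : ∑ i ∈ Finset.range k, μ.rowLen i = ∑ i ∈ Finset.range k, ν.rowLen i :=
    Finset.sum_congr rfl fun i hi => h0 i (Finset.mem_range.1 hi)
  omega

theorem mul_rowLen_le_sum (ν : YoungDiagram) (k l : ℕ) (h : k ≤ l + 1) :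
    k * ν.rowLen l ≤ ∑ i ∈ Finset.range k, ν.rowLen i := by
  have := Finset.card_nsmul_le_sum (Finset.range k) ν.rowLen (ν.rowLen l) fun i hi =>
    ν.rowLen_anti i l (by have := Finset.mem_range.1 hi; omega)
  simpa using this

/-! ### Chains of strips with descents -/

/-- For horizontal strips `μ / κ` and `ν / μ`, all boxes of `μ / κ` lie to the left of those of
`ν / μ`, so that numbering the boxes of either strip from left to right, and those of `μ / κ`
first, produces no descent between the two strips. -/
def NoDescent (κ μ ν : YoungDiagram) : Prop :=
  ∃ r, (∀ i < r, μ.rowLen i = κ.rowLen i) ∧ ∀ i, r < i → ν.rowLen i = μ.rowLen i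

open Classical in
/-- The number of chains of horizontal strips from `⊥` to `μ` whose strip sizes are, from the last
one to the first, given by the list, with a descent between any two consecutive strips, including
the last strip and `ν / μ`. -/
noncomputable def descentChains : List ℕ → YoungDiagram → YoungDiagram → ℕ
  | [], μ, _ => if μ = ⊥ then 1 else 0
  | b :: β, μ, ν =>
    ∑ κ ∈ removeStrip μ b, if NoDescent κ μ ν then 0 else descentChains β κ μ

theorem descentChains_nil_pos {μ ν : YoungDiagram} : 0 < descentChains [] μ ν ↔ μ = ⊥ := by
  rw [descentChains]
  split_ifs with h <;> simp [h]

theorem descentChains_cons_pos {b : ℕ} {β : List ℕ} {μ ν : YoungDiagram} :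
    0 < descentChains (b :: β) μ ν ↔ ∃ κ, IsHorizontalStrip μ κ ∧ κ.card + b = μ.card ∧
      ¬ NoDescent κ μ ν ∧ 0 < descentChains β κ μ := by
  rw [descentChains, Finset.sum_pos_iff]
  constructor
  · rintro ⟨κ, hκ, h⟩
    rw [mem_removeStrip] at hκ
    split_ifs at h with h1
    · exact absurd h (lt_irrefl _)
    · exact ⟨κ, hκ.1, hκ.2, h1, h⟩
  · rintro ⟨κ, h1, h2, h3, h4⟩
    exact ⟨κ, mem_removeStrip.2 ⟨h1, h2⟩, by rwa [if_neg h3]⟩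

/-! ### Admissible diagrams: necessity -/

/-- The conditions, symmetric in the row lengths, that characterize the Schur support of a ribbon
whose row lengths satisfy the strict triangle inequality: `ν` lies in an interval of the dominance
order. -/
structure Admissible (s : Multiset ℕ) (ν : YoungDiagram) : Prop where
  card_eq : ν.card = s.sum
  tail_le : ∀ t ≤ s, ∀ k, t.card + k = s.card → ν.tail k ≤ t.sum
  rowLen_zero_le : ν.rowLen 0 + s.card ≤ ν.card + 1

/-- Two estimates cover the tail bounds. If t contains a, the rows from k on gain at most the a
boxes of the strip. Otherwise t is a submultiset of s, and the interlacing of ν with μ compares row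
k + 1 + i of ν with row k + i of μ. The bound on row 0 is what `ht` provides. -/
theorem Admissible.cons {s : Multiset ℕ} {μ ν : YoungDiagram} {a : ℕ} (h : Admissible s μ)
    (hs : IsHorizontalStrip ν μ) (hc : μ.card + a = ν.card) (ht : s.card ≤ ν.tail 1) :
    Admissible (a ::ₘ s) ν := by
  refine ⟨by rw [← hc, h.card_eq, Multiset.sum_cons, add_comm], fun t hts k hk => ?_, ?_⟩
  · rw [Multiset.card_cons] at hk
    by_cases ha : a ∈ t
    · obtain ⟨t', rfl⟩ := Multiset.exists_cons_of_mem ha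
      rw [Multiset.card_cons] at hk
      have h1 := h.tail_le t' ((Multiset.cons_le_cons_iff a).1 hts) k (by omega)
      have h2 := sum_rowLen_add_tail μ k
      have h3 := sum_rowLen_add_tail ν k
      have h4 := Finset.sum_le_sum fun i (_ : i ∈ Finset.range k) => (hs i).1
      rw [Multiset.sum_cons]
      omega
    · have h1 : t ≤ s := by
        rwa [← Multiset.erase_le_iff_le_cons, Multiset.erase_of_notMem ha] at hts
      have h2 := Multiset.card_le_card h1
      obtain ⟨k, rfl⟩ : ∃ k', k = k' + 1 := ⟨k - 1, by omega⟩
      refine le_trans (tail_le_of_rowLen_le fun i => ?_) (h.tail_le t h1 k (by omega))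
      have := (hs (k + i)).2
      rwa [show k + 1 + i = k + i + 1 by omega]
  · have := ν.rowLen_zero_add_tail_one
    rw [Multiset.card_cons]
    omega

/-- Every descent pushes at least one box of the later strip below row 0, so the number of boxes
below row 0 grows with the number of strips. -/
theorem admissible_of_descentChains_pos {β : List ℕ} {a : ℕ} {μ ν : YoungDiagram}
    (hs : IsHorizontalStrip ν μ) (hc : μ.card + a = ν.card) (h : 0 < descentChains β μ ν) :
    Admissible (a ::ₘ (β : Multiset ℕ)) ν := by
  induction β generalizing a μ ν with
  | nil =>
    rw [descentChains_nil_pos] at h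
    subst h
    refine Admissible.cons ⟨by simp, fun t _ k _ => ?_, ?_⟩ hs hc (by simp)
    · simp [tail]
    · have := rowLen_zero_add_tail_one ⊥
      simp only [Multiset.coe_nil, Multiset.card_zero]
      omega
  | cons b β ih =>
    obtain ⟨κ, h1, h2, h3, h4⟩ := descentChains_cons_pos.1 h
    have h5 := ih h1 h2 h4
    rw [← Multiset.cons_coe]
    refine Admissible.cons h5 hs hc ?_
    have h6 := h5.rowLen_zero_le
    have h7 := μ.rowLen_zero_add_tail_one
    suffices μ.tail 1 < ν.tail 1 by omega
    by_contra! h8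
    -- With no new box below row 0, the strip `ν / μ` lies entirely in row 0, to the right of
    -- everything before it, and the descent is lost.
    refine h3 ⟨0, by simp, fun i hi => ?_⟩
    have hM := le_max_left ν.card μ.card
    have hM' := le_max_right ν.card μ.card
    have h9 : ∑ i ∈ Finset.range (max ν.card μ.card), μ.rowLen (1 + i) =
        ∑ i ∈ Finset.range (max ν.card μ.card), ν.rowLen (1 + i) := by
      refine le_antisymm (Finset.sum_le_sum fun i _ => (hs _).1) ?_
      rw [← tail_eq_sum hM, ← tail_eq_sum hM']
      exact h8
    rw [Finset.sum_eq_sum_iff_of_le fun i _ => (hs _).1] at h9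
    obtain ⟨j, rfl⟩ : ∃ j, i = 1 + j := ⟨i - 1, by omega⟩
    by_cases hj : j < max ν.card μ.card
    · exact (h9 j (Finset.mem_range.2 hj)).symm
    · rw [rowLen_eq_zero (by omega), rowLen_eq_zero (by omega)]

/-! ### Sufficiency under the triangle inequality -/

/-- Any three members of `s` satisfy the strict triangle inequality. -/
def IsTriangular (s : Multiset ℕ) : Prop :=
  ∀ x y z, x ::ₘ y ::ₘ {z} ≤ s → z < x + y

theorem IsTriangular.mono {s t : Multiset ℕ} (h : IsTriangular t) (hst : s ≤ t) :
    IsTriangular s :=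
  fun x y z hs => h x y z (hs.trans hst)

theorem two_mul_card_le_sum {s : Multiset ℕ} (h : ∀ x ∈ s, 2 ≤ x) : 2 * s.card ≤ s.sum := by
  have := Multiset.card_nsmul_le_sum h
  simpa [mul_comm] using this

theorem IsTriangular.sum_le {s : Multiset ℕ} {x y : ℕ} (h : IsTriangular (x ::ₘ y ::ₘ s)) :
    s.sum ≤ s.card * (x + y - 1) := by
  have := Multiset.sum_le_card_nsmul s (x + y - 1) fun z hz => by
    have := h x y z (Multiset.cons_le_cons _ (Multiset.cons_le_cons _
      (Multiset.singleton_le.2 hz)))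
    omega
  simpa using this

/-- If `ν / μ` ends in the last row of `ν`, then the strip before it has a descent to `ν / μ`
as soon as it meets a higher row. -/
theorem not_noDescent {κ μ ν : YoungDiagram} {i l : ℕ} (hi : i < l)
    (h : κ.rowLen i ≠ μ.rowLen i) (hl : μ.rowLen l ≠ ν.rowLen l) : ¬ NoDescent κ μ ν := by
  rintro ⟨r, h1, h2⟩
  rcases lt_or_ge i r with hr | hr
  · exact h (h1 i hr).symm
  · exact hl (h2 l (by omega)).symm

/-- Admissibility is tested against t enlarged by a, and against t itself one row further down. The
first bound is used when a strip of size a lies wholly in rows from k on, the second when it removes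
as much from those rows as a horizontal strip can. -/
theorem admissible_tail_bound {s : Multiset ℕ} {ν : YoungDiagram} {a : ℕ}
    (h : Admissible (a ::ₘ s) ν) {t : Multiset ℕ} {k : ℕ} (ht : t ≤ s)
    (hk : t.card + k = s.card) : ν.tail k ≤ a + t.sum ∧ ν.tail (k + 1) ≤ t.sum := by
  constructor
  · have := h.tail_le (a ::ₘ t) (Multiset.cons_le_cons a ht) k (by simp; omega)
    simpa using this
  · exact h.tail_le t (ht.trans (Multiset.le_cons_self s a)) (k + 1) (by simp; omega)

/-- Removing a strip from the lowest possible rows, except for the boxes of the first row that have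
to go for the sake of `Admissible.rowLen_zero_le`. -/
theorem Admissible.exists_lowest_strip {s : Multiset ℕ} {ν : YoungDiagram} {a : ℕ}
    (h : Admissible (a ::ₘ s) ν) (h2 : ∀ x ∈ a ::ₘ s, 2 ≤ x) (htri : IsTriangular (a ::ₘ s))
    (hs : s ≠ 0) {L : ℕ} (hL : L = min a (ν.tail 1 + 1 - s.card)) :
    ∃ μ, IsHorizontalStrip ν μ ∧ μ.card + a = ν.card ∧ Admissible s μ ∧
      ∀ k, μ.tail (k + 1) + min L (ν.rowLen (k + 1)) = ν.tail (k + 1) := by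
  have hsc : 0 < s.card := Multiset.card_pos.2 hs
  have hc := h.card_eq
  have htop := h.rowLen_zero_le
  rw [Multiset.sum_cons] at hc
  rw [Multiset.card_cons] at htop
  have e0 := ν.rowLen_zero_add_tail_one
  have e1 := ν.tail_succ 1
  have ha0 : a ≤ ν.rowLen 0 := by
    have := (admissible_tail_bound h le_rfl (add_zero _)).2
    rw [zero_add] at this
    omega
  have anti1 := ν.rowLen_anti 0 1 (by omega)
  -- Row 0 has to supply the boxes not taken below it without becoming shorter than row 1. If it
  -- could not, the cap L would be below row 1 and below a, making row 1 longer than `s.sum + 1 -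
  -- s.card`. As twice row 1 is at most the size of ν, this contradicts a < x + y for two members x,
  -- y of s, the other members being at least 2.
  have hroom : a ≤ ν.rowLen 0 - ν.rowLen 1 + min L (ν.rowLen 1) := by
    by_contra! hlt
    have hL1 : L < ν.rowLen 1 ∧ L = ν.tail 1 + 1 - s.card := by omega
    have hs2 : 2 ≤ s.card := by omega
    obtain ⟨x, hx⟩ := Multiset.card_pos_iff_exists_mem.1 hsc
    obtain ⟨t, rfl⟩ := Multiset.exists_cons_of_mem hx
    rw [Multiset.card_cons] at hs2
    obtain ⟨y, hy⟩ := Multiset.card_pos_iff_exists_mem.1 (show 0 < t.card by omega)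
    obtain ⟨t, rfl⟩ := Multiset.exists_cons_of_mem hy
    have h3 := htri x y a (Multiset.le_iff_exists_add.2 ⟨t, by
      rw [Multiset.cons_swap a x, Multiset.cons_swap a y]
      simp⟩)
    have h4 := two_mul_card_le_sum (s := t) fun z hz => h2 z (by simp [hz])
    simp only [Multiset.sum_cons, Multiset.card_cons] at *
    omega
  -- A horizontal strip has at most `ν.rowLen (k + 1)` boxes in rows from k + 1 on, so a lowest one
  -- with L boxes available below row 0 has `min L (ν.rowLen (k + 1))` there. The row lengths are
  -- differences of these numbers.
  set f : ℕ → ℕ := fun k => match k with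
    | 0 => ν.rowLen 0 - a + min L (ν.rowLen 1)
    | k + 1 => ν.rowLen (k + 1) - L + min L (ν.rowLen (k + 2)) with hf
  have hfi : ∀ i, f i ≤ ν.rowLen i ∧ ν.rowLen (i + 1) ≤ f i := by
    intro i
    have h3 := ν.rowLen_anti i (i + 1) (by omega)
    rcases i with _ | i
    · simp only [hf, zero_add] at h3 ⊢
      omega
    · simp only [hf, add_assoc, Nat.reduceAdd] at h3 ⊢
      omega
  have hanti : Antitone f := antitone_nat_of_succ_le fun i => (hfi (i + 1)).1.trans (hfi i).2
  obtain ⟨μ, hμ⟩ := exists_rowLen_eq hanti (n := ν.card)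
    (Nat.le_zero.1 ((hfi _).1.trans (rowLen_eq_zero le_rfl).le))
  have hstrip : IsHorizontalStrip ν μ := fun i => by rw [hμ]; exact hfi i
  have htail : ∀ k, ν.tail (k + 1) - min L (ν.rowLen (k + 1)) = μ.tail (k + 1) := by
    have key := eq_tail (ν := μ) (M := ν.card)
      (t := fun k => match k with
        | 0 => μ.rowLen 0 + (ν.tail 1 - min L (ν.rowLen 1))
        | k + 1 => ν.tail (k + 1) - min L (ν.rowLen (k + 1))) ?_ ?_
    · exact fun k => key (k + 1)
    · rintro (_ | k)
      · rfl
      · simp only [hμ, hf]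
        have h3 := ν.tail_succ (k + 1)
        have h4 := ν.tail_succ (k + 2)
        simp only [add_assoc, Nat.reduceAdd] at h3 h4 ⊢
        omega
    · rintro (_ | k) hk
      · have := rowLen_eq_zero (ν := ν) hk
        have h3 := hfi 0
        have h4 := ν.tail_eq_zero this
        simp only [hμ]
        omega
      · have := ν.tail_eq_zero (rowLen_eq_zero hk)
        simp only
        omega
  have htail' : ∀ k, μ.tail (k + 1) + min L (ν.rowLen (k + 1)) = ν.tail (k + 1) := by
    intro k
    have h3 := ν.tail_succ (k + 1)
    have h4 := htail k
    omega
  have hcard : μ.card + a = ν.card := by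
    have h3 := μ.rowLen_zero_add_tail_one
    have h4 := htail' 0
    rw [hμ] at h3
    simp only [hf, zero_add] at h3 h4
    omega
  refine ⟨μ, hstrip, hcard, ⟨by omega, ?_, ?_⟩, htail'⟩
  · intro t ht k hk
    have hb := admissible_tail_bound h ht hk
    rcases k with _ | k
    · rw [tail_zero] at hb ⊢
      omega
    · have h3 := htail' k
      have h4 := ν.tail_succ (k + 1)
      -- Either the strip is as large as possible from row k + 1 on and the tail of μ is the next
      -- tail of ν, or all a boxes are taken there, or L is the cap imposed by row 0. In the last
      -- case the tail left over is at most `t.card`, because each of the rows 1 to k has a box.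
      by_cases hLk : ν.rowLen (k + 1) ≤ L
      · omega
      by_cases hLa : L = a
      · omega
      have h5 := sum_rowLen_add_tail ν (k + 1)
      have h6 := mul_rowLen_le_sum (k := k) (l := k + 1)
      have h7 := two_mul_card_le_sum (s := t) fun z hz =>
        h2 z (Multiset.mem_cons_of_mem (Multiset.subset_of_le ht hz))
      have h8 : k ≤ ∑ i ∈ Finset.range k, ν.rowLen (i + 1) := by
        have := Finset.card_nsmul_le_sum (Finset.range k) (fun i => ν.rowLen (i + 1)) 1
          fun i hi => by
            have := ν.rowLen_anti (i + 1) (k + 1) (by have := Finset.mem_range.1 hi; omega)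
            omega
        simpa using this
      rw [Finset.sum_range_succ'] at h5
      omega
  · have h3 := μ.rowLen_zero_add_tail_one
    have h4 := htail' 0
    simp only [zero_add] at h4
    omega

/-- Removing a strip that has one box in the last but one row and its other boxes in the
last row. -/
theorem Admissible.exists_two_row_strip {s : Multiset ℕ} {ν : YoungDiagram} {a l : ℕ}
    (h : Admissible (a ::ₘ s) ν) (h2 : ∀ x ∈ a ::ₘ s, 2 ≤ x) (htri : IsTriangular (a ::ₘ s))
    (hl : l + 1 < s.card) (hl0 : ν.rowLen (l + 2) = 0)
    (hgap : ν.rowLen (l + 1) + 2 ≤ ν.rowLen l) (ha : a ≤ ν.rowLen (l + 1))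
    (hσ : a + s.card ≤ ν.tail 1 + 1) :
    ∃ μ, IsHorizontalStrip ν μ ∧ μ.card + a = ν.card ∧ Admissible s μ ∧
      μ.rowLen (l + 1) + (a - 1) = ν.rowLen (l + 1) ∧ μ.rowLen l + 1 = ν.rowLen l := by
  have ha2 := h2 a (Multiset.mem_cons_self a s)
  have hc := h.card_eq
  rw [Multiset.sum_cons] at hc
  set f : ℕ → ℕ := fun k => ν.rowLen k - (if k = l + 1 then a - 1 else 0) -
    (if k = l then 1 else 0) with hf
  have hfi : ∀ i, f i ≤ ν.rowLen i ∧ ν.rowLen (i + 1) ≤ f i := by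
    intro i
    have := ν.rowLen_anti i (i + 1) (by omega)
    simp only [hf]
    split_ifs with h3 h4 h4
    · omega
    · subst h3
      simp only [show l + 1 + 1 = l + 2 from rfl, hl0] at *
      omega
    · subst h4
      omega
    · omega
  have hanti : Antitone f := antitone_nat_of_succ_le fun i => (hfi (i + 1)).1.trans (hfi i).2
  obtain ⟨μ, hμ⟩ := exists_rowLen_eq hanti (n := ν.card)
    (Nat.le_zero.1 ((hfi _).1.trans (rowLen_eq_zero le_rfl).le))
  have hstrip : IsHorizontalStrip ν μ := fun i => by rw [hμ]; exact hfi i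
  have hμl1 : μ.rowLen (l + 1) + (a - 1) = ν.rowLen (l + 1) := by
    rw [hμ]
    simp only [hf, if_true, Nat.succ_ne_self, if_false]
    omega
  have hμl : μ.rowLen l + 1 = ν.rowLen l := by
    rw [hμ]
    simp only [hf, if_true, (Nat.succ_ne_self l).symm, if_false]
    omega
  have hν2 := tail_eq_zero hl0
  have hμ2 : μ.tail (l + 2) = 0 := tail_eq_zero (Nat.le_zero.1 ((hstrip _).1.trans hl0.le))
  have hν1 : ν.tail (l + 1) = ν.rowLen (l + 1) + ν.tail (l + 2) := ν.tail_succ (l + 1)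
  have hμ1 : μ.tail (l + 1) = μ.rowLen (l + 1) + μ.tail (l + 2) := μ.tail_succ (l + 1)
  have hνl := ν.tail_succ l
  have hμl' := μ.tail_succ l
  have htail : ∀ j ≤ l, μ.tail (l - j) + a = ν.tail (l - j) := by
    intro j
    induction j with
    | zero =>
      intro _
      rw [Nat.sub_zero]
      omega
    | succ j ih =>
      intro hj
      have h3 := ih (by omega)
      have h4 := ν.tail_succ (l - (j + 1))
      have h5 := μ.tail_succ (l - (j + 1))
      rw [show l - (j + 1) + 1 = l - j by omega] at h4 h5
      have h6 := hμ (l - (j + 1))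
      simp only [hf] at h6
      rw [if_neg (by omega), if_neg (by omega)] at h6
      omega
  have htail' : ∀ k ≤ l, μ.tail k + a = ν.tail k := fun k hk => by
    have := htail (l - k) (by omega)
    rwa [show l - (l - k) = k by omega] at this
  have hcard : μ.card + a = ν.card := by
    have := htail' 0 (by omega)
    rwa [tail_zero, tail_zero] at this
  refine ⟨μ, hstrip, hcard, ⟨by omega, ?_, ?_⟩, hμl1, hμl⟩
  · intro t ht k hk
    have hb := admissible_tail_bound h ht hk
    rcases lt_trichotomy k (l + 1) with hkl | rfl | hkl
    · have := htail' k (by omega)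
      omega
    -- Only the last row, which loses a - 1 boxes instead of a, can violate a bound. It would then
    -- have at least `a + t.sum` boxes, and by `hgap` the last two rows would have at least `2 * (a
    -- + t.sum) + 2`. The bound for `x ::ₘ t` makes x exceed `a + t.sum`, against x < a + y with y
    -- in t.
    · by_contra! hlt
      obtain ⟨u, rfl⟩ := Multiset.le_iff_exists_add.1 ht
      rw [Multiset.card_add] at hk hl
      obtain ⟨x, hx⟩ := Multiset.card_pos_iff_exists_mem.1 (show 0 < u.card by omega)
      obtain ⟨y, hy⟩ := Multiset.card_pos_iff_exists_mem.1 (show 0 < t.card by omega)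
      have h3 : x ::ₘ t ≤ t + u := by
        rw [← Multiset.singleton_add, add_comm]
        exact add_le_add le_rfl (Multiset.singleton_le.2 hx)
      have h4 := htri a y x (by
        refine Multiset.cons_le_cons a (le_trans ?_ h3)
        exact (Multiset.pair_comm y x).trans_le
          (Multiset.cons_le_cons x (Multiset.singleton_le.2 hy)))
      have h5 := (admissible_tail_bound h h3 (k := l) (by simp; omega)).1
      have h6 := Multiset.single_le_sum (fun _ _ => Nat.zero_le _) y hy
      rw [Multiset.sum_cons] at h5
      omega
    · have h3 : μ.tail k ≤ μ.tail (l + 2) := tail_le_of_rowLen_le fun i =>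
        μ.rowLen_anti _ _ (by omega)
      omega
  · have h3 := μ.rowLen_zero_add_tail_one
    have h4 := ν.rowLen_zero_add_tail_one
    have h5 := (hstrip 0).1
    omega

/-- Every member of s besides x is at most a + x - 1, and there are at most p of them. The
inequality rules out diagrams with p + 1 rows of length about a + x. -/
theorem IsTriangular.mul_card_lt {s : Multiset ℕ} {a x p : ℕ} (h : IsTriangular (a ::ₘ s))
    (hx : x ∈ s) (hs : s.card ≤ p + 1) (ha : 0 < a) :
    a + s.sum + p ≤ (p + 1) * (a + x) := by
  obtain ⟨t, rfl⟩ := Multiset.exists_cons_of_mem hx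
  have h1 := h.sum_le
  rw [Multiset.card_cons] at hs
  rw [Multiset.sum_cons]
  have h2 : t.card * (a + x - 1) ≤ p * (a + x - 1) := Nat.mul_le_mul_right _ (by omega)
  obtain ⟨y, hy⟩ : ∃ y, a + x = y + 1 := ⟨a + x - 1, by omega⟩
  have h3 : (p + 1) * (a + x) = p * (a + x - 1) + p + (a + x) := by
    rw [hy, Nat.add_sub_cancel]
    ring
  omega

/-- An admissible diagram is the end of a chain with descents. If its last two rows, numbered `l`
and `l + 1`, satisfy the given conditions, then the last strip can be chosen to meet a row other
than the last one. -/
theorem exists_descentChains_pos (β : List ℕ) (a : ℕ) (ν : YoungDiagram)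
    (h : Admissible (a ::ₘ (β : Multiset ℕ)) ν) (h2 : ∀ x ∈ a ::ₘ (β : Multiset ℕ), 2 ≤ x)
    (htri : IsTriangular (a ::ₘ (β : Multiset ℕ))) :
    (∃ μ, IsHorizontalStrip ν μ ∧ μ.card + a = ν.card ∧ 0 < descentChains β μ ν) ∧
    ∀ l, 0 < ν.rowLen (l + 1) → ν.rowLen (l + 2) = 0 →
      (ν.tail 1 = β.length ∨ ν.rowLen (l + 1) + 2 ≤ ν.rowLen l ∧
        (l + 1 < β.length ∨ ∀ x ∈ a ::ₘ (β : Multiset ℕ), ν.rowLen (l + 1) < x)) →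
      ∃ μ, IsHorizontalStrip ν μ ∧ μ.card + a = ν.card ∧ 0 < descentChains β μ ν ∧
        ∃ i < l + 1, μ.rowLen i ≠ ν.rowLen i := by
  induction β generalizing a ν with
  | nil =>
    have hc := h.card_eq
    have ht := (admissible_tail_bound h le_rfl (k := 0) (by simp)).2
    simp only [Multiset.coe_nil, Multiset.sum_zero, zero_add, Multiset.sum_cons] at ht hc
    refine ⟨⟨⊥, fun i => ⟨(rowLen_eq_zero (Nat.zero_le i)).le.trans (Nat.zero_le _), ?_⟩, ?_,
      descentChains_nil_pos.2 rfl⟩, ?_⟩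
    · have h3 := ν.tail_succ 1
      have h4 := ν.rowLen_anti 1 (i + 1) (by omega)
      omega
    · rw [hc, add_zero]
      exact zero_add a
    · intro l hl
      have h3 := ν.tail_succ 1
      have h4 := ν.rowLen_anti 1 (l + 1) (by omega)
      omega
  | cons b β ih =>
    rw [← Multiset.cons_coe] at *
    have ha2 := h2 a (Multiset.mem_cons_self a _)
    have hb2 := h2 b (by simp)
    have h2' : ∀ x ∈ b ::ₘ (β : Multiset ℕ), 2 ≤ x := fun x hx => h2 x (Multiset.mem_cons_of_mem hx)
    have htri' := htri.mono (Multiset.le_cons_self _ a)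
    have hc := h.card_eq
    have htop := h.rowLen_zero_le
    have e0 := ν.rowLen_zero_add_tail_one
    simp only [Multiset.card_cons, Multiset.coe_card] at htop
    -- Once `ν / μ` meets the last row l + 1, a descent only requires the preceding strip to meet a
    -- higher row. This is automatic if μ has no row l + 1; otherwise it is the second half of the
    -- induction hypothesis.
    have step : ∀ l μ, IsHorizontalStrip ν μ → μ.card + a = ν.card →
        Admissible (b ::ₘ (β : Multiset ℕ)) μ → ν.rowLen (l + 2) = 0 →
        μ.rowLen (l + 1) ≠ ν.rowLen (l + 1) →
        (0 < μ.rowLen (l + 1) → μ.tail 1 = β.length ∨ μ.rowLen (l + 1) + 2 ≤ μ.rowLen l ∧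
          (l + 1 < β.length ∨ ∀ x ∈ b ::ₘ (β : Multiset ℕ), μ.rowLen (l + 1) < x)) →
        0 < descentChains (b :: β) μ ν := by
      intro l μ hs hcard hadm hl hne himp
      have ihμ := ih b μ hadm h2' htri'
      have hl' : μ.rowLen (l + 2) = 0 := Nat.le_zero.1 ((hs _).1.trans hl.le)
      rw [descentChains_cons_pos]
      rcases Nat.eq_zero_or_pos (μ.rowLen (l + 1)) with h0 | h0
      · obtain ⟨κ, hκ1, hκ2, hκ3⟩ := ihμ.1
        have h3 : μ.tail (l + 1) = 0 := tail_eq_zero h0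
        obtain ⟨i, hi, hi'⟩ := exists_rowLen_ne (μ := κ) (ν := μ) (k := l + 1) (by omega)
        exact ⟨κ, hκ1, hκ2, not_noDescent hi hi' hne, hκ3⟩
      · obtain ⟨κ, hκ1, hκ2, hκ3, i, hi, hi'⟩ := ihμ.2 l h0 hl' (himp h0)
        exact ⟨κ, hκ1, hκ2, not_noDescent hi hi' hne, hκ3⟩
    have hmul : ∀ l, (l + 1) * ν.rowLen l + ν.rowLen (l + 1) ≤ ν.card := fun l => by
      have h3 := mul_rowLen_le_sum ν (l + 1) l le_rfl
      have h4 := sum_rowLen_add_tail ν (l + 1)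
      have h5 := ν.tail_succ (l + 1)
      omega
    obtain ⟨L, hL⟩ : ∃ L, L = min a (ν.tail 1 + 1 - (b ::ₘ (β : Multiset ℕ)).card) := ⟨_, rfl⟩
    obtain ⟨μ, hμs, hμc, hμadm, hμt⟩ :=
      h.exists_lowest_strip h2 htri (Multiset.cons_ne_zero) hL
    simp only [Multiset.card_cons, Multiset.coe_card] at hL
    have hμtop := hμadm.rowLen_zero_le
    have eμ0 := μ.rowLen_zero_add_tail_one
    simp only [Multiset.card_cons, Multiset.coe_card] at hμtop
    have lowest : ∀ l, 0 < ν.rowLen (l + 1) → ν.rowLen (l + 2) = 0 →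
        0 < descentChains (b :: β) μ ν := by
      intro l hl hl0
      have hνt : ν.tail (l + 2) = 0 := tail_eq_zero hl0
      have hμt2 : μ.tail (l + 2) = 0 := tail_eq_zero (Nat.le_zero.1 ((hμs _).1.trans hl0.le))
      have t1 : ν.tail (l + 1) = ν.rowLen (l + 1) + ν.tail (l + 2) := ν.tail_succ (l + 1)
      have t2 : μ.tail (l + 1) = μ.rowLen (l + 1) + μ.tail (l + 2) := μ.tail_succ (l + 1)
      have t3 := hμt l
      have t4 := hμt 0
      rw [zero_add] at t4
      have anti := ν.rowLen_anti 1 (l + 1) (by omega)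
      refine step l μ hμs hμc hμadm hl0 (by omega) fun hpos => ?_
      -- If all a boxes come from the last row, that row is now at least a ≥ 2 shorter than the row
      -- above, and `IsTriangular.mul_card_lt` excludes the case of few strips and a short x. If L
      -- is the cap imposed by row 0, then μ attains the minimal number of boxes below row 0.
      by_cases hLa : L = a
      · right
        have hrow : μ.rowLen l = ν.rowLen l := by
          rcases l with _ | l
          · simp only [zero_add] at t1 t2 t3 hνt hμt2 hpos
            omega
          · have t5 := hμt l
            have t6 := ν.tail_succ (l + 1)
            have t7 := μ.tail_succ (l + 1)
            have anti2 := ν.rowLen_anti (l + 1) (l + 1 + 1) (by omega)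
            omega
        have anti3 := ν.rowLen_anti l (l + 1) (by omega)
        refine ⟨by omega, ?_⟩
        by_contra! hcon
        obtain ⟨hlen, x, hx, hxle⟩ := hcon
        have h3 := htri.mul_card_lt hx (p := l + 1) (by simp; omega) (by omega)
        have h4 := hmul l
        have h5 : (l + 1) * (a + x) ≤ (l + 1) * ν.rowLen l := Nat.mul_le_mul_left _ (by omega)
        have h6 : (l + 1 + 1) * (a + x) = (l + 1) * (a + x) + (a + x) := by ring
        rw [Multiset.sum_cons] at hc
        omega
      · left
        omega
    constructor
    · obtain ⟨l, hl, hl0⟩ : ∃ l, 0 < ν.rowLen (l + 1) ∧ ν.rowLen (l + 2) = 0 := by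
        have hex : ∃ n, ν.rowLen (n + 2) = 0 := ⟨ν.card, rowLen_eq_zero (by omega)⟩
        refine ⟨Nat.find hex, ?_, Nat.find_spec hex⟩
        rcases h3 : Nat.find hex with _ | n
        · rw [zero_add]
          by_contra! h4
          have h5 := tail_eq_zero (Nat.le_zero.1 h4)
          omega
        · exact Nat.pos_of_ne_zero (Nat.find_min hex (m := n) (by omega))
      exact ⟨μ, hμs, hμc, lowest l hl hl0⟩
    · intro l hl hl0 hyp
      have hνt : ν.tail (l + 2) = 0 := tail_eq_zero hl0
      have t1 : ν.tail (l + 1) = ν.rowLen (l + 1) + ν.tail (l + 2) := ν.tail_succ (l + 1)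
      have t3 := hμt l
      rw [List.length_cons] at hyp
      -- If fewer than a boxes come from the last row, the lowest strip already meets a higher row.
      -- Otherwise L = a fits into the last row, and one box has to be moved up.
      by_cases hsmall : min L (ν.rowLen (l + 1)) < a
      · exact ⟨μ, hμs, hμc, lowest l hl hl0, exists_rowLen_ne (by omega)⟩
      · obtain ⟨hgap, hlen⟩ := hyp.resolve_left (by omega)
        have hlen' : l + 1 < β.length + 1 := hlen.resolve_right fun h3 => by
          have := h3 a (Multiset.mem_cons_self a _)
          omega
        obtain ⟨μ', hs', hc', hadm', hrow1, hrow⟩ := h.exists_two_row_strip h2 htri (l := l)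
          (by simpa using hlen') hl0 hgap (by omega) (by simp; omega)
        refine ⟨μ', hs', hc', step l μ' hs' hc' hadm' hl0 (by omega) fun hpos => Or.inr
          ⟨by omega, ?_⟩, l, by omega, by omega⟩
        -- Here a + x is at most one more than the last row, and the gap of two makes the rows above
        -- it at least a + x + 1 long, which gives too many boxes in total.
        by_contra! hcon
        obtain ⟨hlen2, x, hx, hxle⟩ := hcon
        have h3 := htri.mul_card_lt hx (p := l + 1) (by simp; omega) (by omega)
        have h4 := hmul l
        have h5 : (l + 1) * (a + x + 1) ≤ (l + 1) * ν.rowLen l := Nat.mul_le_mul_left _ (by omega)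
        have h6 : (l + 1 + 1) * (a + x) + (l + 1) = (l + 1) * (a + x + 1) + (a + x) := by ring
        rw [Multiset.sum_cons] at hc
        omega

/-! ### Ribbon coefficients and their recurrence -/

open Classical in
/-- The coefficient of `s_ν` in the Schur expansion of the ribbon Schur function of the given row
lengths. -/
noncomputable def ribbonCoeff : List ℕ → YoungDiagram → ℕ
  | [], ν => if ν = ⊥ then 1 else 0
  | a :: β, ν => ∑ μ ∈ removeStrip ν a, descentChains β μ ν

theorem ribbonCoeff_pos_iff {α : List ℕ} (hα : α ≠ []) (h2 : ∀ x ∈ α, 2 ≤ x)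
    (htri : IsTriangular (α : Multiset ℕ)) {ν : YoungDiagram} :
    0 < ribbonCoeff α ν ↔ Admissible (α : Multiset ℕ) ν := by
  obtain ⟨a, β, rfl⟩ := List.exists_cons_of_ne_nil hα
  rw [← Multiset.cons_coe] at *
  rw [ribbonCoeff, Finset.sum_pos_iff]
  simp only [mem_removeStrip, and_assoc]
  constructor
  · rintro ⟨μ, hs, hc, h⟩
    exact admissible_of_descentChains_pos hs hc h
  · intro h
    exact (exists_descentChains_pos β a ν h (by simpa using h2) htri).1

theorem IsHorizontalStrip.of_le_of_le {κ μ ν : YoungDiagram} (h : IsHorizontalStrip ν κ)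
    (h1 : ∀ i, κ.rowLen i ≤ μ.rowLen i) (h2 : ∀ i, μ.rowLen i ≤ ν.rowLen i) :
    IsHorizontalStrip μ κ ∧ IsHorizontalStrip ν μ :=
  ⟨fun i => ⟨h1 i, (h2 _).trans (h i).2⟩, fun i => ⟨h2 i, (h i).2.trans (h1 i)⟩⟩

/-- Above the separating row μ agrees with κ, below it with ν, so each interlacing inequality is
inherited from one of the two strips. -/
theorem NoDescent.isHorizontalStrip {κ μ ν : YoungDiagram} (h : NoDescent κ μ ν)
    (h1 : IsHorizontalStrip μ κ) (h2 : IsHorizontalStrip ν μ) : IsHorizontalStrip ν κ := by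
  obtain ⟨r, hr1, hr2⟩ := h
  refine fun i => ⟨(h1 i).1.trans (h2 i).1, ?_⟩
  rcases lt_or_ge i r with hi | hi
  · exact (h2 i).2.trans (hr1 i hi).le
  · exact (hr2 (i + 1) (by omega)).le.trans (h1 i).2

/-- The middle diagram agrees with κ above its separating row and with ν below it. Such cuts of `ν /
κ` are linearly ordered by the place of the cut, so their size determines them. -/
theorem NoDescent.le_total {κ μ μ' ν : YoungDiagram} (h : NoDescent κ μ ν)
    (h' : NoDescent κ μ' ν) (h1 : κ ≤ μ) (h2 : μ ≤ ν) (h1' : κ ≤ μ') (h2' : μ' ≤ ν) :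
    μ ≤ μ' ∨ μ' ≤ μ := by
  obtain ⟨r, hr1, hr2⟩ := h
  obtain ⟨r', hr1', hr2'⟩ := h'
  have key : (∀ i, μ.rowLen i ≤ μ'.rowLen i) ∨ ∀ i, μ'.rowLen i ≤ μ.rowLen i := by
    have e1 := fun i => rowLen_le_of_le h1 i
    have e2 := fun i => rowLen_le_of_le h2 i
    have e1' := fun i => rowLen_le_of_le h1' i
    have e2' := fun i => rowLen_le_of_le h2' i
    rcases lt_trichotomy r r' with hlt | rfl | hlt
    · right
      intro i
      rcases lt_or_ge r i with hi | hi
      · exact (e2' i).trans (hr2 i hi).le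
      · exact (hr1' i (by omega)).le.trans (e1 i)
    · rcases _root_.le_total (μ.rowLen r) (μ'.rowLen r) with hle | hle
      · left
        intro i
        rcases lt_trichotomy i r with hi | rfl | hi
        · exact (hr1 i hi).le.trans (e1' i)
        · exact hle
        · exact (e2 i).trans (hr2' i hi).le
      · right
        intro i
        rcases lt_trichotomy i r with hi | rfl | hi
        · exact (hr1' i hi).le.trans (e1 i)
        · exact hle
        · exact (e2' i).trans (hr2 i hi).le
    · left
      intro i
      rcases lt_or_ge r' i with hi | hi
      · exact (e2 i).trans (hr2' i hi).le
      · exact (hr1 i (by omega)).le.trans (e1' i)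
  exact key.imp le_of_rowLen_le le_of_rowLen_le

/-- A horizontal strip splits into the part formed by its `b` leftmost boxes and the rest. -/
theorem IsHorizontalStrip.exists_noDescent {κ ν : YoungDiagram} {a b : ℕ}
    (h : IsHorizontalStrip ν κ) (hc : κ.card + (a + b) = ν.card) :
    ∃ μ, IsHorizontalStrip ν μ ∧ μ.card + a = ν.card ∧ IsHorizontalStrip μ κ ∧
      κ.card + b = μ.card ∧ NoDescent κ μ ν := by
  have hex : ∃ r, ν.tail (r + 1) ≤ κ.tail (r + 1) + b := by
    refine ⟨ν.card, ?_⟩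
    rw [tail_eq_zero (rowLen_eq_zero (by omega))]
    exact Nat.zero_le _
  obtain ⟨r, hr, hmin⟩ : ∃ r, ν.tail (r + 1) ≤ κ.tail (r + 1) + b ∧
      κ.tail r + b ≤ ν.tail r := by
    refine ⟨Nat.find hex, Nat.find_spec hex, ?_⟩
    rcases h0 : Nat.find hex with _ | r
    · rw [tail_zero, tail_zero]
      omega
    · have := Nat.find_min hex (m := r) (by omega)
      omega
  have hle : κ.tail (r + 1) ≤ ν.tail (r + 1) := tail_le_of_rowLen_le fun i => (h _).1
  have hν := ν.tail_succ r
  have hκ := κ.tail_succ r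
  -- The cut after b boxes falls in row r: lower rows go to the first part, higher rows to the
  -- second, and row r takes what is missing from b.
  set f : ℕ → ℕ := fun i => if i < r then κ.rowLen i else if i = r then
    κ.rowLen r + (κ.tail (r + 1) + b - ν.tail (r + 1)) else ν.rowLen i with hf
  have hfi : ∀ i, κ.rowLen i ≤ f i ∧ f i ≤ ν.rowLen i := by
    intro i
    have := (h i).1
    simp only [hf]
    split_ifs with h1 h2
    · exact ⟨le_rfl, this⟩
    · subst h2
      omega
    · exact ⟨this, le_rfl⟩
  have hanti : Antitone f :=
    antitone_nat_of_succ_le fun i => (hfi (i + 1)).2.trans ((h i).2.trans (hfi i).1)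
  obtain ⟨μ, hμ⟩ := exists_rowLen_eq hanti (n := ν.card)
    (Nat.le_zero.1 ((hfi _).2.trans (rowLen_eq_zero le_rfl).le))
  have hstrips := h.of_le_of_le (μ := μ) (fun i => by rw [hμ]; exact (hfi i).1)
    (fun i => by rw [hμ]; exact (hfi i).2)
  have hlow : ∀ i, i < r → μ.rowLen i = κ.rowLen i := fun i hi => by
    rw [hμ]
    simp only [hf, if_pos hi]
  have hhigh : ∀ i, r < i → ν.rowLen i = μ.rowLen i := fun i hi => by
    rw [hμ]
    simp only [hf]
    rw [if_neg (by omega), if_neg (by omega)]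
  have hmid : μ.rowLen r = κ.rowLen r + (κ.tail (r + 1) + b - ν.tail (r + 1)) := by
    rw [hμ]
    simp [hf]
  have ht : μ.tail (r + 1) = ν.tail (r + 1) := le_antisymm
    (tail_le_of_rowLen_le fun i => (hhigh _ (by omega)).ge)
    (tail_le_of_rowLen_le fun i => (hhigh _ (by omega)).le)
  have hcard : κ.card + b = μ.card := by
    have h1 := sum_rowLen_add_tail μ r
    have h2 := sum_rowLen_add_tail κ r
    have h3 := μ.tail_succ r
    have h4 : ∑ i ∈ Finset.range r, μ.rowLen i = ∑ i ∈ Finset.range r, κ.rowLen i :=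
      Finset.sum_congr rfl fun i hi => hlow i (Finset.mem_range.1 hi)
    omega
  exact ⟨μ, hstrips.2, by omega, hstrips.1, hcard, r, hlow, hhigh⟩

/-- A descent depends on the later strip only through its lowest row. As `μ / κ` is nonempty and
lies to the left of `ν / μ`, it has the same lowest row as `ν / κ`. -/
theorem NoDescent.noDescent_iff {ι κ μ ν : YoungDiagram} (h : NoDescent κ μ ν)
    (h1 : κ ≤ μ) (h2 : μ ≤ ν) (hne : κ ≠ μ) : NoDescent ι κ μ ↔ NoDescent ι κ ν := by
  obtain ⟨r, hr1, hr2⟩ := h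
  obtain ⟨i, hi⟩ : ∃ i, κ.rowLen i ≠ μ.rowLen i := by
    by_contra! h0
    exact hne (ext_rowLen h0)
  constructor
  · rintro ⟨p, hp1, hp2⟩
    refine ⟨p, hp1, fun j hj => ?_⟩
    have h3 : r ≤ i := by
      by_contra! h4
      exact hi (hr1 i h4).symm
    have h4 : i ≤ p := by
      by_contra! h5
      exact hi (hp2 i h5).symm
    rw [hr2 j (by omega), hp2 j hj]
  · rintro ⟨p, hp1, hp2⟩
    refine ⟨p, hp1, fun j hj => le_antisymm ?_ (rowLen_le_of_le h1 j)⟩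
    exact (rowLen_le_of_le h2 j).trans (hp2 j hj).le

theorem NoDescent.descentChains_eq {κ μ ν : YoungDiagram} (h : NoDescent κ μ ν)
    (h1 : κ ≤ μ) (h2 : μ ≤ ν) (hne : κ ≠ μ) (β : List ℕ) :
    descentChains β κ μ = descentChains β κ ν := by
  cases β with
  | nil => rfl
  | cons b β =>
    rw [descentChains, descentChains]
    refine Finset.sum_congr rfl fun ι _ => ?_
    have := h.noDescent_iff (ι := ι) h1 h2 hne
    split_ifs <;> tauto

/-- Chains are sorted by whether the last two strips have a descent between them. If not, they merge
into one strip of size a + b, which can be cut back in exactly one way. The condition on b makes the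
left part nonempty, so that descents from earlier strips survive the merging. -/
theorem sum_ribbonCoeff_removeStrip {a b : ℕ} (hb : 0 < b) (β : List ℕ) (ν : YoungDiagram) :
    ∑ μ ∈ removeStrip ν a, ribbonCoeff (b :: β) μ =
      ribbonCoeff (a :: b :: β) ν + ribbonCoeff ((a + b) :: β) ν := by
  classical
  simp only [ribbonCoeff]
  have hsplit : ∀ μ, ∑ κ ∈ removeStrip μ b, descentChains β κ μ =
      descentChains (b :: β) μ ν +
        ∑ κ ∈ (removeStrip μ b).filter (fun κ => NoDescent κ μ ν), descentChains β κ μ := by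
    intro μ
    rw [descentChains, Finset.sum_filter, ← Finset.sum_add_distrib]
    refine Finset.sum_congr rfl fun κ _ => ?_
    split_ifs <;> simp
  simp only [hsplit, Finset.sum_add_distrib]
  congr 1
  rw [Finset.sum_sigma']
  refine Finset.sum_bij (fun p _ => p.2) ?_ ?_ ?_ ?_
  · rintro ⟨μ, κ⟩ hp
    simp only [Finset.mem_sigma, mem_removeStrip, Finset.mem_filter] at hp ⊢
    obtain ⟨⟨h1, h2⟩, ⟨h3, h4⟩, h5⟩ := hp
    exact ⟨h5.isHorizontalStrip h3 h1, by omega⟩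
  · rintro ⟨μ, κ⟩ hp ⟨μ', κ'⟩ hp' (rfl : κ = κ')
    simp only [Finset.mem_sigma, mem_removeStrip, Finset.mem_filter] at hp hp'
    obtain ⟨⟨h1, h2⟩, ⟨h3, h4⟩, h5⟩ := hp
    obtain ⟨⟨h1', h2'⟩, ⟨h3', h4'⟩, h5'⟩ := hp'
    have : μ = μ' := by
      rcases h5.le_total h5' h3.le h1.le h3'.le h1'.le with h | h
      · exact eq_of_le_of_card_eq h (by omega)
      · exact (eq_of_le_of_card_eq h (by omega)).symm
    rw [this]
  · intro κ hκ
    rw [mem_removeStrip] at hκ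
    obtain ⟨μ, h1, h2, h3, h4, h5⟩ := hκ.1.exists_noDescent hκ.2
    exact ⟨⟨μ, κ⟩, by simp [h1, h2, h3, h4, h5], rfl⟩
  · rintro ⟨μ, κ⟩ hp
    simp only [Finset.mem_sigma, mem_removeStrip, Finset.mem_filter] at hp ⊢
    obtain ⟨⟨h1, h2⟩, ⟨h3, h4⟩, h5⟩ := hp
    refine h5.descentChains_eq h3.le h1.le ?_ β
    rintro rfl
    omega

/-! ### The local growth rule and the Pieri rule -/

open Classical in
/-- The Young diagram with the given row lengths, if there is one. -/
noncomputable def ofRowLen (f : ℕ → ℕ) : YoungDiagram :=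
  if h : ∃ ν : YoungDiagram, ∀ i, ν.rowLen i = f i then h.choose else ⊥

theorem rowLen_ofRowLen {f : ℕ → ℕ} (hf : ∀ i, f (i + 1) ≤ f i) {n : ℕ} (hn : f n = 0) (i : ℕ) :
    (ofRowLen f).rowLen i = f i := by
  have h := exists_rowLen_eq (antitone_nat_of_succ_le hf) hn
  rw [ofRowLen, dif_pos h]
  exact h.choose_spec i

theorem ofRowLen_eq {f : ℕ → ℕ} {ν : YoungDiagram} (h : ∀ i, ν.rowLen i = f i) :
    ofRowLen f = ν := by
  have h' : ∃ ν : YoungDiagram, ∀ i, ν.rowLen i = f i := ⟨ν, h⟩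
  rw [ofRowLen, dif_pos h']
  exact ext_rowLen fun i => by rw [h'.choose_spec, h]

/-- Summing over the rows, the max terms and the shifted min terms recombine, since max + min is the
sum of the two arguments. -/
theorem card_add_card_of_local_rule {κ μ ν ρ : YoungDiagram} {j : ℕ}
    (h0 : ρ.rowLen 0 = max (ν.rowLen 0) (κ.rowLen 0) + j)
    (h : ∀ i, ρ.rowLen (i + 1) + μ.rowLen i =
      max (ν.rowLen (i + 1)) (κ.rowLen (i + 1)) + min (ν.rowLen i) (κ.rowLen i)) :
    ρ.card + μ.card = ν.card + κ.card + j := by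
  obtain ⟨M, h1, h2, h3, h4⟩ : ∃ M, κ.card ≤ M ∧ μ.card ≤ M ∧ ν.card ≤ M ∧ ρ.card ≤ M :=
    ⟨κ.card + μ.card + ν.card + ρ.card, by omega, by omega, by omega, by omega⟩
  rw [card_eq_sum (M := M + 1) (ν := ρ) (by omega), card_eq_sum h2,
    card_eq_sum (M := M + 1) (ν := ν) (by omega), card_eq_sum (M := M + 1) (ν := κ) (by omega),
    Finset.sum_range_succ', h0, add_right_comm, ← Finset.sum_add_distrib,
    Finset.sum_congr rfl fun i _ => h i, Finset.sum_add_distrib]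
  have e1 := Finset.sum_range_succ' (fun i => max (ν.rowLen i) (κ.rowLen i)) M
  have e2 := Finset.sum_range_succ (fun i => min (ν.rowLen i) (κ.rowLen i)) M
  rw [rowLen_eq_zero h3, Nat.zero_min] at e2
  have e3 : ∑ i ∈ Finset.range (M + 1), max (ν.rowLen i) (κ.rowLen i) +
      ∑ i ∈ Finset.range (M + 1), min (ν.rowLen i) (κ.rowLen i) =
      ∑ i ∈ Finset.range (M + 1), ν.rowLen i + ∑ i ∈ Finset.range (M + 1), κ.rowLen i := by
    rw [← Finset.sum_add_distrib, ← Finset.sum_add_distrib]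
    exact Finset.sum_congr rfl fun i _ => max_add_min _ _
  omega

/-- The bijection behind the commutation of adding and removing horizontal strips. -/
theorem sum_removeStrip_addStrip {R : Type*} [CommRing R] (x : R) (g : YoungDiagram → R)
    (ν : YoungDiagram) (k : ℕ) :
    ∑ j ∈ Finset.range (k + 1), ∑ μ ∈ stripBelow ν, ∑ κ ∈ addStrip μ (k - j),
      x ^ (j + (ν.card - μ.card)) * g κ =
    ∑ ρ ∈ addStrip ν k, ∑ κ ∈ stripBelow ρ, x ^ (ρ.card - κ.card) * g κ := by
  simp only [Finset.sum_sigma']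
  have up : ∀ {j : ℕ} {μ κ : YoungDiagram}, IsHorizontalStrip ν μ → IsHorizontalStrip κ μ →
      ∀ i, (ofRowLen fun i => match i with
        | 0 => max (ν.rowLen 0) (κ.rowLen 0) + j
        | i + 1 => max (ν.rowLen (i + 1)) (κ.rowLen (i + 1)) + min (ν.rowLen i) (κ.rowLen i)
            - μ.rowLen i).rowLen i = match i with
        | 0 => max (ν.rowLen 0) (κ.rowLen 0) + j
        | i + 1 => max (ν.rowLen (i + 1)) (κ.rowLen (i + 1)) + min (ν.rowLen i) (κ.rowLen i)
            - μ.rowLen i := by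
    intro j μ κ h1 h2
    refine rowLen_ofRowLen ?_ (n := ν.card + κ.card + 1) ?_
    · rintro (_ | i)
      · have := h1 0
        have := h2 0
        simp only [zero_add] at *
        omega
      · have := h1 i
        have := h2 i
        have := h1 (i + 1)
        have := h2 (i + 1)
        simp only
        omega
    · have e1 := rowLen_eq_zero (ν := ν) (k := ν.card + κ.card) (by omega)
      have e2 := rowLen_eq_zero (ν := ν) (k := ν.card + κ.card + 1) (by omega)
      have e3 := rowLen_eq_zero (ν := κ) (k := ν.card + κ.card + 1) (by omega)
      simp only
      omega
  have down : ∀ {ρ κ : YoungDiagram}, IsHorizontalStrip ρ ν → IsHorizontalStrip ρ κ →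
      ∀ i, (ofRowLen fun i => max (ν.rowLen (i + 1)) (κ.rowLen (i + 1)) +
        min (ν.rowLen i) (κ.rowLen i) - ρ.rowLen (i + 1)).rowLen i =
        max (ν.rowLen (i + 1)) (κ.rowLen (i + 1)) +
        min (ν.rowLen i) (κ.rowLen i) - ρ.rowLen (i + 1) := by
    intro ρ κ h1 h2
    refine rowLen_ofRowLen ?_ (n := ν.card + κ.card) ?_
    · intro i
      have := h1 i
      have := h2 i
      have := h1 (i + 1)
      have := h2 (i + 1)
      have := h1 (i + 1 + 1)
      have := h2 (i + 1 + 1)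
      omega
    · have e1 := rowLen_eq_zero (ν := ν) (k := ν.card + κ.card) (by omega)
      have e2 := rowLen_eq_zero (ν := ν) (k := ν.card + κ.card + 1) (by omega)
      have e3 := rowLen_eq_zero (ν := κ) (k := ν.card + κ.card + 1) (by omega)
      omega
  -- The growth rule `ρ_{i+1} + μ_i = max(ν_{i+1}, κ_{i+1}) + min(ν_i, κ_i)` can be solved for ρ or
  -- for μ. The number j, not recorded by μ, is the excess of row 0 of ρ over the maximum.
  refine Finset.sum_nbij'
    (fun p => ⟨ofRowLen fun i => match i with
        | 0 => max (ν.rowLen 0) (p.2.2.rowLen 0) + p.1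
        | i + 1 => max (ν.rowLen (i + 1)) (p.2.2.rowLen (i + 1)) +
            min (ν.rowLen i) (p.2.2.rowLen i) - p.2.1.rowLen i, p.2.2⟩)
    (fun q => ⟨q.1.rowLen 0 - max (ν.rowLen 0) (q.2.rowLen 0),
      ofRowLen fun i => max (ν.rowLen (i + 1)) (q.2.rowLen (i + 1)) +
        min (ν.rowLen i) (q.2.rowLen i) - q.1.rowLen (i + 1), q.2⟩) ?_ ?_ ?_ ?_ ?_
  · rintro ⟨j, μ, κ⟩ hp
    simp only [Finset.mem_sigma, Finset.mem_range, mem_stripBelow, mem_addStrip] at hp ⊢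
    obtain ⟨hj, h1, h2, h3⟩ := hp
    have hu := up (j := j) h1 h2
    generalize ofRowLen _ = ρ at hu ⊢
    have hu0 := hu 0
    have hu1 := fun i => hu (i + 1)
    simp only at hu0 hu1
    have hcard := card_add_card_of_local_rule hu0 (μ := μ) fun i => by
      have := h1 i
      have := h2 i
      have := hu1 i
      omega
    refine ⟨⟨?_, by omega⟩, ?_⟩
    · rintro (_ | i)
      · have := h1 0
        have := h2 0
        have := hu1 0
        simp only [zero_add] at *
        omega
      · have := h1 i
        have := h2 i
        have := h1 (i + 1)
        have := h2 (i + 1)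
        have := hu1 i
        have := hu1 (i + 1)
        omega
    · rintro (_ | i)
      · have := h1 0
        have := h2 0
        have := hu1 0
        simp only [zero_add] at *
        omega
      · have := h1 i
        have := h2 i
        have := h1 (i + 1)
        have := h2 (i + 1)
        have := hu1 i
        have := hu1 (i + 1)
        omega
  · rintro ⟨ρ, κ⟩ hq
    simp only [Finset.mem_sigma, Finset.mem_range, mem_stripBelow, mem_addStrip] at hq ⊢
    obtain ⟨⟨h1, h3⟩, h2⟩ := hq
    have hd := down h1 h2
    generalize ofRowLen _ = μ at hd ⊢
    have h10 := h1 0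
    have h20 := h2 0
    have hcard := card_add_card_of_local_rule (κ := κ) (μ := μ) (ν := ν) (ρ := ρ)
      (j := ρ.rowLen 0 - max (ν.rowLen 0) (κ.rowLen 0)) (by omega) fun i => by
      have := h1 i
      have := h2 i
      have := hd i
      omega
    have hκ := card_le_of_le h2.le
    have hs : IsHorizontalStrip ν μ ∧ IsHorizontalStrip κ μ := by
      constructor <;>
      · intro i
        have := h1 i
        have := h2 i
        have := h1 (i + 1)
        have := h2 (i + 1)
        have := hd i
        omega
    have hμ := card_le_of_le hs.1.le
    have hμ' := card_le_of_le hs.2.le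
    exact ⟨by omega, hs.1, hs.2, by omega⟩
  · rintro ⟨j, μ, κ⟩ hp
    simp only [Finset.mem_sigma, Finset.mem_range, mem_stripBelow, mem_addStrip] at hp ⊢
    obtain ⟨hj, h1, h2, h3⟩ := hp
    have hu := up (j := j) h1 h2
    generalize ofRowLen _ = ρ at hu ⊢
    have hu0 := hu 0
    have hu1 := fun i => hu (i + 1)
    simp only at hu0 hu1
    have e1 : ρ.rowLen 0 - max (ν.rowLen 0) (κ.rowLen 0) = j := by omega
    have e2 : (ofRowLen fun i => max (ν.rowLen (i + 1)) (κ.rowLen (i + 1)) +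
        min (ν.rowLen i) (κ.rowLen i) - ρ.rowLen (i + 1)) = μ := ofRowLen_eq fun i => by
      have := h1 i
      have := h2 i
      have := hu1 i
      omega
    rw [e1, e2]
  · rintro ⟨ρ, κ⟩ hq
    simp only [Finset.mem_sigma, mem_stripBelow, mem_addStrip] at hq ⊢
    obtain ⟨⟨h1, h3⟩, h2⟩ := hq
    have hd := down h1 h2
    generalize ofRowLen _ = μ at hd ⊢
    rw [ofRowLen_eq (ν := ρ)]
    rintro (_ | i)
    · have := h1 0
      have := h2 0
      simp only
      omega
    · have := h1 i
      have := h2 i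
      have := hd i
      simp only
      omega
  · rintro ⟨j, μ, κ⟩ hp
    simp only [Finset.mem_sigma, Finset.mem_range, mem_stripBelow, mem_addStrip] at hp ⊢
    obtain ⟨hj, h1, h2, h3⟩ := hp
    have hu := up (j := j) h1 h2
    generalize ofRowLen _ = ρ at hu ⊢
    have hu0 := hu 0
    have hu1 := fun i => hu (i + 1)
    simp only at hu0 hu1
    have hcard := card_add_card_of_local_rule hu0 (μ := μ) fun i => by
      have := h1 i
      have := h2 i
      have := hu1 i
      omega
    have hμ := card_le_of_le h1.le
    have hμ' := card_le_of_le h2.le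
    congr 2
    omega

theorem isHorizontalStrip_bot_iff {μ : YoungDiagram} : IsHorizontalStrip ⊥ μ ↔ μ = ⊥ := by
  constructor
  · intro h
    exact le_bot_iff.1 h.le
  · rintro rfl i
    exact ⟨le_rfl, (rowLen_anti _ _ _ (by omega))⟩

/-- The Pieri rule, for any functions that satisfy the branching rules. -/
theorem pieri_of_branching {R : Type*} [CommRing R] (x : ℕ → R) (S : ℕ → YoungDiagram → R)
    (h : ℕ → ℕ → R) (hS0 : ∀ ν, ν ≠ ⊥ → S 0 ν = 0)
    (hS : ∀ n ν, S (n + 1) ν = ∑ μ ∈ stripBelow ν, x n ^ (ν.card - μ.card) * S n μ)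
    (hh0 : ∀ k, k ≠ 0 → h 0 k = 0) (hh0' : h 0 0 = 1)
    (hh : ∀ n k, h (n + 1) k = ∑ j ∈ Finset.range (k + 1), x n ^ j * h n (k - j))
    (n k : ℕ) (ν : YoungDiagram) : h n k * S n ν = ∑ ρ ∈ addStrip ν k, S n ρ := by
  induction n generalizing k ν with
  | zero =>
    by_cases hν : k = 0 ∧ ν = ⊥
    · obtain ⟨rfl, rfl⟩ := hν
      rw [Finset.sum_eq_single ⊥, hh0', one_mul]
      · exact fun ρ _ hρ => hS0 ρ hρ
      · intro hn
        exact absurd (mem_addStrip.2 ⟨isHorizontalStrip_bot_iff.2 rfl, rfl⟩) hn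
    · rw [Finset.sum_eq_zero]
      · by_cases hk : k = 0
        · rw [hS0 ν fun h0 => hν ⟨hk, h0⟩, mul_zero]
        · rw [hh0 k hk, zero_mul]
      · intro ρ hρ
        refine hS0 ρ ?_
        rintro rfl
        rw [mem_addStrip, isHorizontalStrip_bot_iff] at hρ
        obtain ⟨rfl, hc⟩ := hρ
        exact hν ⟨by omega, rfl⟩
  | succ n ih =>
    simp only [hS]
    rw [hh, ← sum_removeStrip_addStrip, Finset.sum_mul]
    refine Finset.sum_congr rfl fun j _ => ?_
    rw [Finset.mul_sum]
    refine Finset.sum_congr rfl fun μ _ => ?_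
    rw [mul_mul_mul_comm, ih, ← pow_add, Finset.mul_sum]

end YoungDiagram

/-! ### Branching of semistandard tableaux -/

open YoungDiagram MvPowerSeries

theorem sum_single_one_apply {ι : Type*} (s : Finset ι) (f : ι → ℕ) (k : ℕ) :
    (∑ c ∈ s, Finsupp.single (f c) 1 : ℕ →₀ ℕ) k = (s.filter fun c => f c = k).card := by
  rw [Finsupp.finsetSum_apply, Finset.card_filter]
  exact Finset.sum_congr rfl fun c _ => Finsupp.single_apply

theorem finite_setOf_sum_single_eq {ι : Type*} [Finite ι] (s : Finset ι) (d : ℕ →₀ ℕ) :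
    {f : ι → ℕ | (∀ i ∉ s, f i = 0) ∧ ∑ c ∈ s, Finsupp.single (f c) 1 = d}.Finite := by
  refine (Set.Finite.pi' fun _ : ι => (insert 0 d.support).finite_toSet).subset ?_
  rintro f ⟨h0, rfl⟩ i
  by_cases hi : i ∈ s
  · refine Finset.mem_coe.2 (Finset.mem_insert_of_mem ?_)
    rw [Finsupp.mem_support_iff, sum_single_one_apply]
    exact Finset.card_ne_zero_of_mem (Finset.mem_filter.2 ⟨hi, rfl⟩)
  · rw [h0 i hi]
    simp

namespace SemistandardYoungTableau

variable {μ ν : YoungDiagram}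

theorem content_apply (T : SemistandardYoungTableau ν) (k : ℕ) :
    T.content k = (ν.cells.filter fun c => T c.1 c.2 = k).card :=
  sum_single_one_apply _ _ _

theorem content_entry_ne_zero (T : SemistandardYoungTableau ν) {i j : ℕ} (h : (i, j) ∈ ν) :
    T.content (T i j) ≠ 0 := by
  rw [content_apply]
  exact Finset.card_ne_zero_of_mem (a := (i, j)) (Finset.mem_filter.2 ⟨h, rfl⟩)

theorem finite_content_eq (ν : YoungDiagram) (d : ℕ →₀ ℕ) :
    {T : SemistandardYoungTableau ν | T.content = d}.Finite := by
  refine Set.Finite.of_finite_image (f := fun T (c : ν.cells) => T c.1.1 c.1.2)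
    ((finite_setOf_sum_single_eq Finset.univ d).subset ?_) ?_
  · rintro f ⟨T, hT, rfl⟩
    refine ⟨by simp, ?_⟩
    exact (Finset.sum_coe_sort ν.cells fun c => Finsupp.single (T c.1 c.2) 1).trans hT
  · intro T _ T' _ h
    ext i j
    by_cases hc : (i, j) ∈ ν
    · exact congrFun h ⟨(i, j), hc⟩
    · rw [T.zeros hc, T'.zeros hc]

/-- The diagram of the entries less than `n`. -/
def below (T : SemistandardYoungTableau ν) (n : ℕ) : YoungDiagram where
  cells := ν.cells.filter fun c => T c.1 c.2 < n
  isLowerSet := by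
    rintro ⟨i, j⟩ ⟨i', j'⟩ ⟨h1, h2⟩ h
    simp only [Finset.coe_filter, Set.mem_ofPred_eq, YoungDiagram.mem_cells] at h ⊢
    exact ⟨ν.up_left_mem h1 h2 h.1, ((T.row_weak_of_le h2 (ν.up_left_mem h1 le_rfl h.1)).trans
      (T.col_weak h1 h.1)).trans_lt h.2⟩

theorem mem_below {T : SemistandardYoungTableau ν} {n : ℕ} {c : ℕ × ℕ} :
    c ∈ T.below n ↔ c ∈ ν ∧ T c.1 c.2 < n := by
  rw [← YoungDiagram.mem_cells, below, Finset.mem_filter, YoungDiagram.mem_cells]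

/-- The restriction of a tableau to a smaller diagram. -/
def restrict (T : SemistandardYoungTableau ν) (h : μ ≤ ν) : SemistandardYoungTableau μ where
  entry i j := if (i, j) ∈ μ then T i j else 0
  row_weak' hj hc := by
    rw [if_pos hc, if_pos (μ.up_left_mem le_rfl hj.le hc)]
    exact T.row_weak hj (h hc)
  col_strict' hi hc := by
    rw [if_pos hc, if_pos (μ.up_left_mem hi.le le_rfl hc)]
    exact T.col_strict hi (h hc)
  zeros' hc := if_neg hc

theorem restrict_apply (T : SemistandardYoungTableau ν) (h : μ ≤ ν) {i j : ℕ} (hc : (i, j) ∈ μ) :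
    T.restrict h i j = T i j :=
  if_pos hc

/-- The extension of a tableau with entries less than `n` by `n` to a larger diagram. -/
def extend (T : SemistandardYoungTableau μ) (h : IsHorizontalStrip ν μ) (n : ℕ)
    (hT : ∀ i j, (i, j) ∈ μ → T i j < n) : SemistandardYoungTableau ν where
  entry i j := if (i, j) ∈ μ then T i j else if (i, j) ∈ ν then n else 0
  row_weak' {i j1 j2} hj hc := by
    by_cases hc2 : (i, j2) ∈ μ
    · rw [if_pos hc2, if_pos (μ.up_left_mem le_rfl hj.le hc2)]
      exact T.row_weak hj hc2
    · rw [if_neg hc2, if_pos hc]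
      split_ifs with h1
      · exact (hT _ _ h1).le
      · exact le_rfl
      · exact Nat.zero_le _
  col_strict' {i1 i2 j} hi hc := by
    by_cases hc2 : (i2, j) ∈ μ
    · rw [if_pos hc2, if_pos (μ.up_left_mem hi.le le_rfl hc2)]
      exact T.col_strict hi hc2
    · have h1 : (i1, j) ∈ μ := by
        rw [mem_iff_lt_rowLen] at hc ⊢
        exact (hc.trans_le (ν.rowLen_anti _ _ hi)).trans_le (h i1).2
      rw [if_neg hc2, if_pos hc, if_pos h1]
      exact hT _ _ h1
  zeros' {i j} hc := by
    rw [if_neg fun h1 => hc (h.le h1), if_neg hc]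

theorem entry_le_of_content {d : ℕ →₀ ℕ} {n : ℕ} (hd : ∀ i, n < i → d i = 0)
    (T : SemistandardYoungTableau ν) (hT : T.content = d) {i j : ℕ} (hc : (i, j) ∈ ν) :
    T i j ≤ n := by
  by_contra! h
  exact T.content_entry_ne_zero hc (hT ▸ hd _ h)

theorem below_mem_removeStrip {d : ℕ →₀ ℕ} {n : ℕ} (hd : ∀ i, n < i → d i = 0)
    (T : SemistandardYoungTableau ν) (hT : T.content = d) :
    T.below n ∈ removeStrip ν (d n) := by
  have hle : T.below n ≤ ν := fun c hc => (mem_below.1 hc).1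
  rw [mem_removeStrip]
  refine ⟨fun i => ⟨rowLen_le_of_le hle i, ?_⟩, ?_⟩
  · by_contra! h
    have h1 : (i + 1, (T.below n).rowLen i) ∈ ν := mem_iff_lt_rowLen.2 h
    have h2 : (i, (T.below n).rowLen i) ∈ T.below n := mem_below.2
      ⟨ν.up_left_mem (Nat.le_succ i) le_rfl h1,
        (T.col_strict (Nat.lt_succ_self i) h1).trans_le (entry_le_of_content hd T hT h1)⟩
    exact lt_irrefl _ (mem_iff_lt_rowLen.1 h2)
  · rw [← hT, content_apply, YoungDiagram.card, YoungDiagram.card, below,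
      ← Finset.card_filter_add_card_filter_not (s := ν.cells) fun c => T c.1 c.2 < n]
    congr 2
    refine Finset.filter_congr fun c hc => ?_
    have := entry_le_of_content hd T hT (i := c.1) (j := c.2) hc
    omega

/-- The boxes with the largest possible entry n form a horizontal strip, and `restrict` and `extend`
remove and restore it. On power series this becomes `truncateVars_succ_schurFunction`. -/
theorem card_content_eq_sum {d : ℕ →₀ ℕ} {n : ℕ} (hd : ∀ i, n < i → d i = 0) (ν : YoungDiagram) :
    Nat.card {T : SemistandardYoungTableau ν // T.content = d} =
      ∑ μ ∈ removeStrip ν (d n),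
        Nat.card {T : SemistandardYoungTableau μ // T.content = d.erase n} := by
  classical
  have hcard : ∀ (ν : YoungDiagram) (d : ℕ →₀ ℕ),
      Nat.card {T : SemistandardYoungTableau ν // T.content = d} =
      (finite_content_eq ν d).toFinset.card := fun ν d => Nat.card_eq_card_finite_toFinset _
  rw [hcard, Finset.card_eq_sum_card_fiberwise (f := fun T => T.below n)
    (t := removeStrip ν (d n))]
  swap
  · intro T hT
    exact below_mem_removeStrip hd T (by simpa using hT)
  refine Finset.sum_congr rfl fun μ hμ => ?_
  rw [mem_removeStrip] at hμ
  rw [hcard]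
  refine Finset.card_bij (fun T _ => T.restrict hμ.1.le) ?_ ?_ ?_
  · intro T hT
    simp only [Finset.mem_filter, Set.Finite.mem_toFinset, Set.mem_ofPred_eq] at hT ⊢
    obtain ⟨hT, rfl⟩ := hT
    ext k
    rw [content_apply, Finsupp.erase_apply]
    split_ifs with hk
    · rw [Finset.card_eq_zero, Finset.filter_eq_empty_iff]
      rintro ⟨i, j⟩ hc
      rw [restrict_apply _ _ hc]
      have := (mem_below.1 hc).2
      simp only at this
      omega
    · have h0 : d k = T.content k := by rw [hT]
      rw [h0, content_apply]
      congr 1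
      ext ⟨i, j⟩
      simp only [Finset.mem_filter, YoungDiagram.mem_cells]
      constructor
      · rintro ⟨h1, h2⟩
        rw [restrict_apply _ _ h1] at h2
        exact ⟨hμ.1.le h1, h2⟩
      · rintro ⟨h1, h2⟩
        have h3 := entry_le_of_content hd T hT h1
        have h4 : (i, j) ∈ T.below n := mem_below.2 ⟨h1, by simp only; omega⟩
        exact ⟨h4, by rw [restrict_apply _ _ h4, h2]⟩
  · intro T hT T' hT' h
    simp only [Finset.mem_filter, Set.Finite.mem_toFinset, Set.mem_ofPred_eq] at hT hT'
    ext i j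
    by_cases hc : (i, j) ∈ ν
    · by_cases hc' : (i, j) ∈ μ
      · rw [← restrict_apply T hμ.1.le hc', h, restrict_apply T' hμ.1.le hc']
      · have h1 := entry_le_of_content hd T hT.1 hc
        have h2 := entry_le_of_content hd T' hT'.1 hc
        have h3 : ¬ T i j < n := fun h => hc' (hT.2 ▸ mem_below.2 ⟨hc, h⟩)
        have h4 : ¬ T' i j < n := fun h => hc' (hT'.2 ▸ mem_below.2 ⟨hc, h⟩)
        omega
    · rw [T.zeros hc, T'.zeros hc]
  · intro T hT
    simp only [Set.Finite.mem_toFinset, Set.mem_ofPred_eq] at hT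
    have hlt : ∀ i j, (i, j) ∈ μ → T i j < n := by
      intro i j hc
      by_contra! h
      refine T.content_entry_ne_zero hc ?_
      rw [hT, Finsupp.erase_apply]
      split_ifs with h1
      · rfl
      · exact hd _ (lt_of_le_of_ne h (Ne.symm h1))
    have hin : ∀ {i j}, (i, j) ∈ μ → T.extend hμ.1 n hlt i j = T i j := fun hc => if_pos hc
    have hout : ∀ {i j}, (i, j) ∉ μ → (i, j) ∈ ν → T.extend hμ.1 n hlt i j = n := fun hc hc' => by
      change (if _ then _ else _) = _
      rw [if_neg hc, if_pos hc']
    refine ⟨T.extend hμ.1 n hlt, ?_, ?_⟩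
    · simp only [Finset.mem_filter, Set.Finite.mem_toFinset, Set.mem_ofPred_eq]
      constructor
      · ext k
        rw [content_apply]
        by_cases hk : k = n
        · subst hk
          have h1 : ν.cells.filter (fun c => T.extend hμ.1 k hlt c.1 c.2 = k) =
              ν.cells \ μ.cells := by
            ext ⟨i, j⟩
            simp only [Finset.mem_filter, Finset.mem_sdiff, YoungDiagram.mem_cells]
            refine and_congr_right fun hc => ?_
            by_cases hc' : (i, j) ∈ μ
            · have := hlt i j hc'
              simp only [hin hc', hc', not_true_eq_false, iff_false]
              omega
            · simp [hout hc' hc, hc']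
          rw [h1, Finset.card_sdiff_of_subset (cells_subset_iff.2 hμ.1.le)]
          have := hμ.2
          simp only [YoungDiagram.card] at this
          omega
        · have h1 : d k = d.erase n k := (Finsupp.erase_ne hk).symm
          rw [h1, ← hT, content_apply]
          congr 1
          ext ⟨i, j⟩
          simp only [Finset.mem_filter, YoungDiagram.mem_cells]
          by_cases hc' : (i, j) ∈ μ
          · simp [hin hc', hc', hμ.1.le hc']
          · simp only [hc', false_and, iff_false, not_and]
            intro hc
            rw [hout hc' hc]
            exact Ne.symm hk
      · apply SetLike.ext
        rintro ⟨i, j⟩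
        rw [mem_below]
        constructor
        · rintro ⟨h1, h2⟩
          by_contra h3
          rw [hout h3 h1] at h2
          exact lt_irrefl _ h2
        · intro h1
          refine ⟨hμ.1.le h1, ?_⟩
          rw [hin h1]
          exact hlt i j h1
    · ext i j
      by_cases hc : (i, j) ∈ μ
      · rw [restrict_apply _ _ hc, hin hc]
      · rw [zeros _ hc, zeros _ hc]

end SemistandardYoungTableau

/-! ### Truncation to finitely many variables -/

theorem MvPowerSeries.coeff_X_pow_mul_eq {R : Type*} [CommRing R] (n t : ℕ) (f : MvPowerSeries ℕ R)
    (d : ℕ →₀ ℕ) : coeff d (X n ^ t * f) =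
      if t ≤ d n then coeff (d - Finsupp.single n t) f else 0 := by
  rw [X_pow_eq, coeff_monomial_mul]
  simp [Finsupp.single_le_iff]

theorem Finsupp.sub_single_eq_erase (d : ℕ →₀ ℕ) (n : ℕ) :
    d - Finsupp.single n (d n) = d.erase n := by
  ext i
  rw [Finsupp.tsub_apply, Finsupp.erase_apply, Finsupp.single_apply]
  split_ifs with h1 h2 h2
  · subst h1
    simp
  · exact absurd h1.symm h2
  · exact absurd h2.symm h1
  · rfl

open Classical in
/-- The part of a power series that involves only the variables with index less than `n`. -/
noncomputable def truncateVars (n : ℕ) (f : MvPowerSeries ℕ ℤ) : MvPowerSeries ℕ ℤ :=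
  fun d => if ∀ i, n ≤ i → d i = 0 then f d else 0

open Classical in
theorem coeff_truncateVars (n : ℕ) (f : MvPowerSeries ℕ ℤ) (d : ℕ →₀ ℕ) :
    coeff d (truncateVars n f) = if ∀ i, n ≤ i → d i = 0 then coeff d f else 0 :=
  rfl

/-- The complete homogeneous symmetric function. -/
noncomputable def completeSymmetric (k : ℕ) : MvPowerSeries ℕ ℤ :=
  fun d => if d.degree = k then 1 else 0

theorem coeff_completeSymmetric (k : ℕ) (d : ℕ →₀ ℕ) :
    coeff d (completeSymmetric k) = if d.degree = k then 1 else 0 :=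
  rfl

open Classical in
/-- The only power of `X n` that contributes to a coefficient of `X n ^ t * truncateVars n f`. -/
theorem coeff_X_pow_mul_truncateVars (n t : ℕ) (f : MvPowerSeries ℕ ℤ) (d : ℕ →₀ ℕ) :
    coeff d (X n ^ t * truncateVars n f) =
      if (∀ i, n < i → d i = 0) ∧ t = d n then coeff (d.erase n) f else 0 := by
  rw [coeff_X_pow_mul_eq, coeff_truncateVars]
  by_cases ht : t = d n
  · subst ht
    rw [if_pos le_rfl, Finsupp.sub_single_eq_erase]
    refine if_congr ⟨fun h => ⟨fun i hi => ?_, rfl⟩, fun h i hi => ?_⟩ rfl rfl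
    · rw [← h i hi.le, Finsupp.erase_ne hi.ne']
    · rw [Finsupp.erase_apply]
      split_ifs with h1
      · rfl
      · exact h.1 i (lt_of_le_of_ne hi (Ne.symm h1))
  · rw [if_neg (show ¬ (_ ∧ t = d n) from fun h => ht h.2)]
    split_ifs with h1 h2
    · have := h2 n le_rfl
      rw [Finsupp.tsub_apply, Finsupp.single_eq_same] at this
      omega
    · rfl
    · rfl

theorem coeff_schurFunction (ν : YoungDiagram) (d : ℕ →₀ ℕ) :
    coeff d (schurFunction ν) = Nat.card {T : SemistandardYoungTableau ν // T.content = d} :=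
  rfl

theorem truncateVars_zero_schurFunction {ν : YoungDiagram} (hν : ν ≠ ⊥) :
    truncateVars 0 (schurFunction ν) = 0 := by
  ext d
  rw [coeff_truncateVars, coeff_schurFunction]
  split_ifs with h
  · have hd : d = 0 := Finsupp.ext fun i => h i (Nat.zero_le i)
    rw [Nat.card_eq_zero.2 (Or.inl ⟨?_⟩)]
    · simp
    · rintro ⟨T, hT⟩
      refine hν (le_bot_iff.1 fun c hc => ?_)
      exact absurd (by rw [hT, hd]; rfl) (T.content_entry_ne_zero (i := c.1) (j := c.2) hc)
  · simp

theorem truncateVars_succ_schurFunction (n : ℕ) (ν : YoungDiagram) :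
    truncateVars (n + 1) (schurFunction ν) =
      ∑ μ ∈ stripBelow ν, X n ^ (ν.card - μ.card) * truncateVars n (schurFunction μ) := by
  classical
  ext d
  rw [map_sum]
  simp only [coeff_X_pow_mul_truncateVars]
  rw [coeff_truncateVars]
  by_cases hd : ∀ i, n < i → d i = 0
  · rw [if_pos (show ∀ i, n + 1 ≤ i → d i = 0 from hd), coeff_schurFunction,
      SemistandardYoungTableau.card_content_eq_sum hd, removeStrip, Finset.sum_filter]
    push_cast
    refine Finset.sum_congr rfl fun μ hμ => ?_
    have := card_le_of_le (mem_stripBelow.1 hμ).le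
    rw [coeff_schurFunction]
    refine if_congr ⟨fun h => ⟨hd, by omega⟩, fun h => ?_⟩ rfl rfl
    have := h.2
    omega
  · rw [if_neg (fun h => hd fun i hi => h i hi)]
    simp [hd]

theorem truncateVars_succ_completeSymmetric (n k : ℕ) :
    truncateVars (n + 1) (completeSymmetric k) = ∑ j ∈ Finset.range (k + 1),
      X n ^ j * truncateVars n (completeSymmetric (k - j)) := by
  classical
  ext d
  rw [map_sum]
  simp only [coeff_X_pow_mul_truncateVars, coeff_completeSymmetric]
  rw [coeff_truncateVars, coeff_completeSymmetric]
  by_cases hd : ∀ i, n < i → d i = 0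
  · rw [if_pos (show ∀ i, n + 1 ≤ i → d i = 0 from hd)]
    have hdeg : d.degree = d n + (d.erase n).degree := by
      conv_lhs => rw [← Finsupp.single_add_erase n d]
      rw [map_add, Finsupp.degree_single]
    rw [Finset.sum_congr rfl (g := fun j => if j = d n then
      (if (d.erase n).degree = k - j then 1 else 0) else 0)
      fun j _ => if_congr (and_iff_right hd) rfl rfl]
    simp only [Finset.sum_ite_eq', Finset.mem_range]
    split_ifs <;> first | rfl | omega
  · rw [if_neg (fun h => hd fun i hi => h i hi)]
    simp [hd]

/-- Monomials dividing `x^d` involve no variable outside d, so identities between products can be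
checked in finitely many variables. -/
theorem truncateVars_mul (n : ℕ) (f g : MvPowerSeries ℕ ℤ) (d : ℕ →₀ ℕ)
    (hd : ∀ i, n ≤ i → d i = 0) :
    coeff d (f * g) = coeff d (truncateVars n f * truncateVars n g) := by
  rw [coeff_mul, coeff_mul]
  refine Finset.sum_congr rfl fun p hp => ?_
  rw [Finset.HasAntidiagonal.mem_antidiagonal] at hp
  rw [coeff_truncateVars, coeff_truncateVars, if_pos, if_pos]
  · intro i hi
    have := hd i hi
    rw [← hp, Finsupp.add_apply] at this
    omega
  · intro i hi
    have := hd i hi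
    rw [← hp, Finsupp.add_apply] at this
    omega

/-- The Pieri rule. -/
theorem completeSymmetric_mul_schurFunction (k : ℕ) (ν : YoungDiagram) :
    completeSymmetric k * schurFunction ν = ∑ ρ ∈ addStrip ν k, schurFunction ρ := by
  ext d
  obtain ⟨n, hn⟩ : ∃ n, ∀ i, n ≤ i → d i = 0 := by
    refine ⟨d.support.sup id + 1, fun i hi => ?_⟩
    by_contra h
    have := Finset.le_sup (f := id) (Finsupp.mem_support_iff.2 h)
    simp only [id] at this
    omega
  rw [truncateVars_mul n _ _ d hn, pieri_of_branching (R := MvPowerSeries ℕ ℤ) X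
    (fun n ν => truncateVars n (schurFunction ν)) (fun n k => truncateVars n (completeSymmetric k))
    (fun ν hν => truncateVars_zero_schurFunction hν) truncateVars_succ_schurFunction ?_ ?_
    truncateVars_succ_completeSymmetric n k ν, map_sum, map_sum]
  · refine Finset.sum_congr rfl fun ρ _ => ?_
    rw [coeff_truncateVars, if_pos hn]
  · intro k hk
    ext d
    rw [coeff_truncateVars, coeff_completeSymmetric]
    split_ifs with h1 h2
    · have hd : d = 0 := Finsupp.ext fun i => h1 i (Nat.zero_le i)
      rw [hd, map_zero] at h2
      exact absurd h2.symm hk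
    · simp
    · simp
  · ext d
    rw [coeff_truncateVars, coeff_completeSymmetric, coeff_one]
    by_cases hd : d = 0
    · simp [hd]
    · rw [if_neg hd, if_neg]
      exact fun h => hd (Finsupp.ext fun i => h i (Nat.zero_le i))

/-! ### Generating functions of words with prescribed descents -/

/-- The generating function of a family of objects with given contents. -/
noncomputable def generatingSeries {X : Type*} (c : X → ℕ →₀ ℕ) : MvPowerSeries ℕ ℤ :=
  fun d => (Nat.card {x // c x = d} : ℤ)

section generatingSeries

variable {X Y : Type*}

theorem coeff_generatingSeries (c : X → ℕ →₀ ℕ) (d : ℕ →₀ ℕ) :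
    coeff d (generatingSeries c) = (Nat.card {x // c x = d} : ℤ) :=
  rfl

theorem generatingSeries_congr {c : X → ℕ →₀ ℕ} {c' : Y → ℕ →₀ ℕ} (e : X ≃ Y)
    (h : ∀ x, c' (e x) = c x) : generatingSeries c = generatingSeries c' := by
  ext d
  rw [coeff_generatingSeries, coeff_generatingSeries,
    Nat.card_congr (e.subtypeEquiv (q := fun y => c' y = d) fun x => by rw [h])]

theorem generatingSeries_mul (c : X → ℕ →₀ ℕ) (c' : Y → ℕ →₀ ℕ)
    (hc : ∀ d, Finite {x // c x = d}) (hc' : ∀ d, Finite {y // c' y = d}) :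
    generatingSeries c * generatingSeries c' =
      generatingSeries fun p : X × Y => c p.1 + c' p.2 := by
  classical
  ext d
  rw [coeff_mul, coeff_generatingSeries]
  simp only [coeff_generatingSeries]
  have e : {p : X × Y // c p.1 + c' p.2 = d} ≃
      Σ q : Finset.HasAntidiagonal.antidiagonal d, {x // c x = q.1.1} × {y // c' y = q.1.2} :=
    { toFun := fun p => ⟨⟨(c p.1.1, c' p.1.2), Finset.HasAntidiagonal.mem_antidiagonal.2 p.2⟩,
        ⟨p.1.1, rfl⟩, ⟨p.1.2, rfl⟩⟩
      invFun := fun q => ⟨(q.2.1.1, q.2.2.1), by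
        rw [q.2.1.2, q.2.2.2]
        exact Finset.HasAntidiagonal.mem_antidiagonal.1 q.1.2⟩
      left_inv := fun p => rfl
      right_inv := by
        rintro ⟨⟨⟨d1, d2⟩, hq⟩, ⟨x, hx⟩, ⟨y, hy⟩⟩
        dsimp only at hx hy
        subst hx hy
        rfl }
  rw [Nat.card_congr e, Nat.card_sigma]
  push_cast
  rw [← Finset.sum_coe_sort]
  refine Finset.sum_congr rfl fun q _ => ?_
  rw [Nat.card_prod]
  push_cast
  rfl

theorem generatingSeries_add_compl (c : X → ℕ →₀ ℕ) (hc : ∀ d, Finite {x // c x = d})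
    (P : X → Prop) : generatingSeries c = generatingSeries (fun x : {x // P x} => c x) +
      generatingSeries (fun x : {x // ¬ P x} => c x) := by
  classical
  ext d
  rw [map_add]
  simp only [coeff_generatingSeries]
  have h : ∀ Q : X → Prop, {x : {x // Q x} // c x = d} ≃ {x : {x // c x = d} // Q x} := fun Q =>
    { toFun := fun x => ⟨⟨x.1.1, x.2⟩, x.1.2⟩
      invFun := fun x => ⟨⟨x.1.1, x.2⟩, x.1.2⟩
      left_inv := fun _ => rfl
      right_inv := fun _ => rfl }
  rw [Nat.card_congr (h P), Nat.card_congr (h fun x => ¬ P x), ← Nat.cast_add, ← Nat.card_sum,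
    Nat.card_congr (Equiv.sumCompl fun x : {x // c x = d} => P x)]

end generatingSeries

/-- The content of a word. -/
noncomputable def wordContent {N : ℕ} (w : Fin N → ℕ) : ℕ →₀ ℕ :=
  ∑ p, Finsupp.single (w p) 1

theorem finite_wordContent_eq {N : ℕ} (d : ℕ →₀ ℕ) :
    {w : Fin N → ℕ | wordContent w = d}.Finite :=
  (finite_setOf_sum_single_eq Finset.univ d).subset fun _ hw => ⟨by simp, hw⟩

theorem wordContent_append {N a : ℕ} (u : Fin N → ℕ) (v : Fin a → ℕ) :
    wordContent (Fin.append u v) = wordContent u + wordContent v := by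
  simp [wordContent, Fin.sum_univ_add]

theorem toMultiset_wordContent {N : ℕ} (w : Fin N → ℕ) :
    Finsupp.toMultiset (wordContent w) = (List.ofFn w : Multiset ℕ) := by
  induction N with
  | zero => simp [wordContent]
  | succ N ih =>
    have h := ih fun p => w p.succ
    rw [wordContent] at h ⊢
    rw [Fin.sum_univ_succ, map_add, h, List.ofFn_succ, Finsupp.toMultiset_single, one_nsmul,
      Multiset.singleton_add, Multiset.cons_coe]

/-- The descents of the word `w`, that is, the positions with a larger letter than the
next one, are the members of `D`. -/
def HasDescents (D : Set ℕ) {N : ℕ} (w : Fin N → ℕ) : Prop :=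
  ∀ p (h : p + 1 < N), w ⟨p + 1, h⟩ < w ⟨p, (Nat.lt_succ_self p).trans h⟩ ↔ p ∈ D

/-- The generating function of the words of length `N` with the given descents. -/
noncomputable def wordSeries (N : ℕ) (D : Set ℕ) : MvPowerSeries ℕ ℤ :=
  generatingSeries fun w : {w : Fin N → ℕ // HasDescents D w} => wordContent w.1

theorem finite_subtype_wordContent {N : ℕ} (P : (Fin N → ℕ) → Prop) (d : ℕ →₀ ℕ) :
    Finite {w : {w // P w} // wordContent w.1 = d} := by
  have := (finite_wordContent_eq (N := N) d).to_subtype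
  exact Finite.of_injective (fun w => (⟨w.1.1, w.2⟩ : {w : Fin N → ℕ | wordContent w = d}))
    fun w w' h => Subtype.ext (Subtype.ext (congrArg (fun x => x.1) h))

theorem hasDescents_empty_iff {N : ℕ} {w : Fin N → ℕ} : HasDescents ∅ w ↔ Monotone w := by
  constructor
  · intro h
    rcases N with _ | N
    · exact fun i => i.elim0
    · refine Fin.monotone_iff_le_succ.2 fun i => ?_
      have := h i (by omega)
      exact not_lt.1 (this.not.2 (Set.notMem_empty _))
  · intro h p hp
    simp only [Set.mem_empty_iff_false, iff_false, not_lt]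
    exact h (Fin.mk_le_mk.2 (Nat.le_succ p))

/-- A weakly increasing word is the sorted list of its letters, so each monomial of degree a arises
exactly once. -/
theorem wordSeries_empty (a : ℕ) : wordSeries a ∅ = completeSymmetric a := by
  ext d
  rw [coeff_completeSymmetric, wordSeries, coeff_generatingSeries]
  have hdeg : ∀ w : Fin a → ℕ, (wordContent w).degree = a := fun w => by
    simp [wordContent, map_sum]
  split_ifs with hd
  · have huniq : ∀ w w' : Fin a → ℕ, Monotone w → Monotone w' → wordContent w = wordContent w' →
        w = w' := by
      intro w w' h h' hc
      have h1 := congrArg Finsupp.toMultiset hc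
      rw [toMultiset_wordContent, toMultiset_wordContent, Multiset.coe_eq_coe] at h1
      exact List.ofFn_injective (h1.eq_of_sortedLE h.sortedLE_ofFn h'.sortedLE_ofFn)
    have hex : ∃ w : Fin a → ℕ, Monotone w ∧ wordContent w = d := by
      obtain ⟨l, hl⟩ : ∃ l, l = (Finsupp.toMultiset d).sort (· ≤ ·) := ⟨_, rfl⟩
      have hlen : l.length = a := by
        rw [hl, Multiset.length_sort, Finsupp.card_toMultiset, ← hd]
        rfl
      subst hlen
      refine ⟨l.get, ?_, ?_⟩
      · have h1 : l.Pairwise (· ≤ ·) := hl ▸ Multiset.pairwise_sort _ _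
        exact h1.sortedLE.monotone_get
      · apply Finsupp.orderIsoMultiset.injective
        change Finsupp.toMultiset _ = Finsupp.toMultiset _
        rw [toMultiset_wordContent, List.ofFn_get, hl, Multiset.sort_eq]
    obtain ⟨w, hw, hwd⟩ := hex
    rw [Nat.card_eq_one_iff_unique.2 ⟨⟨?_⟩, ⟨⟨w, hasDescents_empty_iff.2 hw⟩, hwd⟩⟩, Nat.cast_one]
    rintro ⟨⟨u, hu⟩, hu'⟩ ⟨⟨v, hv⟩, hv'⟩
    have := huniq u v (hasDescents_empty_iff.1 hu) (hasDescents_empty_iff.1 hv)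
      (hu'.trans hv'.symm)
    subst this
    rfl
  · rw [Nat.card_eq_zero.2 (Or.inl ⟨?_⟩), Nat.cast_zero]
    rintro ⟨⟨w, hw⟩, hw'⟩
    exact hd (hw' ▸ hdeg w)

theorem hasDescents_append_iff {N a : ℕ} {u : Fin (N + 1) → ℕ} {v : Fin (a + 1) → ℕ} {D : Set ℕ}
    (hD : ∀ p ∈ D, p < N) :
    (HasDescents D (Fin.append u v) ↔
      (HasDescents D u ∧ HasDescents ∅ v) ∧ ¬ v 0 < u (Fin.last N)) ∧
    (HasDescents (insert N D) (Fin.append u v) ↔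
      (HasDescents D u ∧ HasDescents ∅ v) ∧ v 0 < u (Fin.last N)) := by
  have hleft : ∀ p (h : p < N + 1) (h' : p < N + 1 + (a + 1)),
      Fin.append u v ⟨p, h'⟩ = u ⟨p, h⟩ := fun p h h' => Fin.append_left u v ⟨p, h⟩
  have hright : ∀ p (h : p < a + 1) (h' : N + 1 + p < N + 1 + (a + 1)),
      Fin.append u v ⟨N + 1 + p, h'⟩ = v ⟨p, h⟩ := fun p h h' => Fin.append_right u v ⟨p, h⟩
  have key : ∀ E : Set ℕ, (∀ p < N, p ∈ E ↔ p ∈ D) → (∀ p, N < p → p ∉ E) →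
      (HasDescents E (Fin.append u v) ↔
        (HasDescents D u ∧ HasDescents ∅ v) ∧ (v 0 < u (Fin.last N) ↔ N ∈ E)) := by
    intro E hE hE'
    constructor
    · intro h
      refine ⟨⟨fun p hp => ?_, fun p hp => ?_⟩, ?_⟩
      · have := h p (by omega)
        rwa [hleft _ hp, hleft _ (by omega), hE p (by omega)] at this
      · have := h (N + 1 + p) (by omega)
        have h1 := hright (p + 1) hp (by omega)
        rw [hright p (by omega)] at this
        rw [← h1]
        simp only [Set.mem_empty_iff_false, iff_false]
        exact fun h2 => hE' _ (by omega) (this.1 h2)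
      · have := h N (by omega)
        rwa [hleft N (by omega), show Fin.append u v ⟨N + 1, by omega⟩ = v 0 from
          hright 0 (by omega) (by omega)] at this
    · rintro ⟨⟨h1, h2⟩, h3⟩ p hp
      rcases lt_trichotomy p N with hpN | rfl | hpN
      · rw [hleft _ (by omega), hleft _ (by omega), hE p hpN]
        exact h1 p (by omega)
      · rwa [hleft p (by omega), show Fin.append u v ⟨p + 1, by omega⟩ = v 0 from
          hright 0 (by omega) (by omega)]
      · obtain ⟨q, rfl⟩ : ∃ q, p = N + 1 + q := ⟨p - (N + 1), by omega⟩
        have h4 := h2 q (by omega)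
        rw [hright q (by omega), show Fin.append u v ⟨N + 1 + q + 1, hp⟩ = v ⟨q + 1, by omega⟩ from
          hright (q + 1) (by omega) (by omega), h4]
        simp [hE' (N + 1 + q) (by omega)]
  constructor
  · rw [key D (fun p _ => Iff.rfl) fun p hp h => by have := hD p h; omega]
    simp only [show N ∉ D from fun h => lt_irrefl _ (hD N h), iff_false]
  · rw [key (insert N D) (fun p hp => by simp [hp.ne]) fun p hp h => by
      rcases h with rfl | h
      · exact lt_irrefl _ hp
      · have := hD p h; omega]
    simp

/-- A word with descents D followed by a weakly increasing word is a single longer word; the two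
summands correspond to having or not having a descent at the junction N. -/
theorem wordSeries_mul_completeSymmetric {N a : ℕ} {D : Set ℕ} (hD : ∀ p ∈ D, p < N) :
    wordSeries (N + 1) D * completeSymmetric (a + 1) =
      wordSeries (N + 1 + (a + 1)) (insert N D) + wordSeries (N + 1 + (a + 1)) D := by
  have happ : ∀ w : Fin (N + 1 + (a + 1)) → ℕ,
      Fin.append (fun p => w (Fin.castAdd (a + 1) p)) (fun p => w (Fin.natAdd (N + 1) p)) = w :=
    fun w => Fin.append_castAdd_natAdd
  rw [← wordSeries_empty, wordSeries, wordSeries, generatingSeries_mul _ _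
    (finite_subtype_wordContent _) (finite_subtype_wordContent _), generatingSeries_add_compl _ ?_
    fun p => p.2.1 0 < p.1.1 (Fin.last N)]
  · congr 1
    · refine generatingSeries_congr
        { toFun := fun p => ⟨Fin.append p.1.1.1 p.1.2.1,
            (hasDescents_append_iff hD).2.2 ⟨⟨p.1.1.2, p.1.2.2⟩, p.2⟩⟩
          invFun := fun w =>
            have h := (hasDescents_append_iff hD).2.1 ((happ w.1).symm ▸ w.2)
            ⟨⟨⟨_, h.1.1⟩, ⟨_, h.1.2⟩⟩, h.2⟩
          left_inv := fun p => ?_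
          right_inv := fun w => Subtype.ext (happ w.1) } fun p => ?_
      · apply Subtype.ext
        refine Prod.ext (Subtype.ext ?_) (Subtype.ext ?_)
        · funext i
          exact Fin.append_left _ _ i
        · funext i
          exact Fin.append_right _ _ i
      · exact wordContent_append _ _
    · refine generatingSeries_congr
        { toFun := fun p => ⟨Fin.append p.1.1.1 p.1.2.1,
            (hasDescents_append_iff hD).1.2 ⟨⟨p.1.1.2, p.1.2.2⟩, p.2⟩⟩
          invFun := fun w =>
            have h := (hasDescents_append_iff hD).1.1 ((happ w.1).symm ▸ w.2)
            ⟨⟨⟨_, h.1.1⟩, ⟨_, h.1.2⟩⟩, h.2⟩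
          left_inv := fun p => ?_
          right_inv := fun w => Subtype.ext (happ w.1) } fun p => ?_
      · apply Subtype.ext
        refine Prod.ext (Subtype.ext ?_) (Subtype.ext ?_)
        · funext i
          exact Fin.append_left _ _ i
        · funext i
          exact Fin.append_right _ _ i
      · exact wordContent_append _ _
  · intro d
    have := (finite_wordContent_eq (N := N + 1 + (a + 1)) d).to_subtype
    refine Finite.of_injective (fun p => (⟨Fin.append p.1.1.1 p.1.2.1,
      (wordContent_append _ _).trans p.2⟩ :
      {w : Fin (N + 1 + (a + 1)) → ℕ | wordContent w = d})) fun p q h => ?_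
    have h1 : Fin.append p.1.1.1 p.1.2.1 = Fin.append q.1.1.1 q.1.2.1 :=
      congrArg (fun x => x.1) h
    apply Subtype.ext
    refine Prod.ext (Subtype.ext ?_) (Subtype.ext ?_)
    · funext i
      have := congrFun h1 (Fin.castAdd _ i)
      rwa [Fin.append_left, Fin.append_left] at this
    · funext i
      have := congrFun h1 (Fin.natAdd _ i)
      rwa [Fin.append_right, Fin.append_right] at this

/-! ### Fillings of a ribbon as words -/

/-- The descents of the words that correspond to the fillings of the ribbon with the given row
lengths: the words are read from left to right in each row, starting with the last row. -/
def ribbonDescents : List ℕ → Set ℕ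
  | [] => ∅
  | _ :: β => {p | p + 1 = β.sum} ∪ ribbonDescents β

theorem ribbonDescents_lt {β : List ℕ} {p : ℕ} (h : p ∈ ribbonDescents β) : p + 1 ≤ β.tail.sum := by
  induction β with
  | nil => exact absurd h (Set.notMem_empty p)
  | cons a β ih =>
    rcases h with h | h
    · exact (show p + 1 = β.sum from h).le
    · refine (ih h).trans ?_
      cases β <;> simp

theorem mem_ribbonDescents_ofFn {m : ℕ} {α : Fin m → ℕ} {p : ℕ} :
    p ∈ ribbonDescents (List.ofFn α) ↔ ∃ i, ∑ k ∈ Finset.Ioi i, α k = p + 1 := by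
  induction m with
  | zero => simp [ribbonDescents]
  | succ m ih =>
    rw [List.ofFn_succ, ribbonDescents, Set.mem_union, ih, Fin.exists_fin_succ, Fin.sum_Ioi_zero,
      Set.mem_ofPred_eq, List.sum_ofFn]
    simp only [Fin.sum_Ioi_succ]
    exact or_congr_left eq_comm

theorem SkewSSYT.ext_entry {s : SkewShape} {T T' : SkewSSYT s} (h : T.entry = T'.entry) :
    T = T' := by
  cases T
  cases T'
  congr

namespace ribbon

variable {m : ℕ} {α : Fin m → ℕ}

theorem sum_Ici (α : Fin m → ℕ) (i : Fin m) :
    ∑ k ∈ Finset.Ici i, α k = α i + ∑ k ∈ Finset.Ioi i, α k := by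
  rw [← Finset.Ioi_insert, Finset.sum_insert (by simp)]

theorem mem_cells (hα : ∀ i, 0 < α i) {i j : ℕ} :
    (i, j) ∈ (ribbon α).cells ↔ ∃ h : i < m, ∑ k ∈ Finset.Ioi ⟨i, h⟩, (α k - 1) ≤ j ∧
      j < ∑ k ∈ Finset.Ioi ⟨i, h⟩, (α k - 1) + α ⟨i, h⟩ := by
  have ho : (i, j) ∈ (ribbon α).outer ↔ ∃ h : i < m,
      j < 1 + ∑ k ∈ Finset.Ici ⟨i, h⟩, (α k - 1) := by
    simp [ribbon, youngDiagramOfAntitone, YoungDiagram.mem_ofRowLens]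
  have hi : (i, j) ∈ (ribbon α).inner ↔ ∃ h : i < m,
      j < ∑ k ∈ Finset.Ioi ⟨i, h⟩, (α k - 1) := by
    simp [ribbon, youngDiagramOfAntitone, YoungDiagram.mem_ofRowLens]
  rw [SkewShape.cells, Finset.mem_sdiff, YoungDiagram.mem_cells, YoungDiagram.mem_cells, ho, hi]
  constructor
  · rintro ⟨⟨h, h1⟩, h2⟩
    refine ⟨h, not_lt.1 fun h3 => h2 ⟨h, h3⟩, ?_⟩
    rw [sum_Ici (fun k => α k - 1)] at h1
    have := hα ⟨i, h⟩
    omega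
  · rintro ⟨h, h1, h2⟩
    refine ⟨⟨h, ?_⟩, fun ⟨_, h3⟩ => absurd h3 (not_lt.2 h1)⟩
    rw [sum_Ici (fun k => α k - 1)]
    have := hα ⟨i, h⟩
    omega

/-- Each of the m - 1 - i rows below row i shares one column with its upper neighbour. This is the
offset between columns and places in the reading word. -/
theorem sum_Ioi_sub_one_add (hα : ∀ i, 0 < α i) (i : Fin m) :
    ∑ k ∈ Finset.Ioi i, (α k - 1) + (m - 1 - i) = ∑ k ∈ Finset.Ioi i, α k := by
  have h : (Finset.Ioi i).card = m - 1 - i := by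
    rw [Fin.card_Ioi]
  rw [← h, Finset.card_eq_sum_ones, ← Finset.sum_add_distrib]
  exact Finset.sum_congr rfl fun k _ => Nat.sub_add_cancel (hα k)

theorem sum_Ioi_add_le {f : Fin m → ℕ} {i k : Fin m} (h : i < k) :
    ∑ k ∈ Finset.Ioi k, f k + f k ≤ ∑ k ∈ Finset.Ioi i, f k := by
  rw [add_comm, ← sum_Ici]
  exact Finset.sum_le_sum_of_subset fun x hx => Finset.mem_Ioi.2 (h.trans_le (Finset.mem_Ici.1 hx))

theorem sum_Ioi_of_succ {f : Fin m → ℕ} {i k : Fin m} (h : (k : ℕ) = i + 1) :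
    ∑ k ∈ Finset.Ioi i, f k = ∑ k ∈ Finset.Ioi k, f k + f k := by
  rw [add_comm, ← sum_Ici]
  congr 1
  ext x
  rw [Finset.mem_Ioi, Finset.mem_Ici, Fin.lt_def, Fin.le_def, h]
  rfl

theorem sum_Ioi_add_le_sum {f : Fin m → ℕ} (i : Fin m) :
    ∑ k ∈ Finset.Ioi i, f k + f i ≤ ∑ k, f k := by
  rw [add_comm, ← sum_Ici]
  exact Finset.sum_le_sum_of_subset (Finset.subset_univ _)

theorem exists_row {p : ℕ} (hp : p < ∑ k, α k) :
    ∃ i, ∑ k ∈ Finset.Ioi i, α k ≤ p ∧ p < ∑ k ∈ Finset.Ioi i, α k + α i := by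
  rcases m with _ | m
  · simp at hp
  · have hex : ∃ n, ∃ h : n < m + 1, ∑ k ∈ Finset.Ioi ⟨n, h⟩, α k ≤ p :=
      ⟨m, by omega, by
        rw [show (⟨m, Nat.lt_succ_self m⟩ : Fin (m + 1)) = Fin.last m from rfl,
          ← Fin.top_eq_last, Finset.Ioi_top]
        exact Nat.zero_le p⟩
    classical
    obtain ⟨n, ⟨h, hle⟩, hmin⟩ : ∃ n, (∃ h : n < m + 1, ∑ k ∈ Finset.Ioi ⟨n, h⟩, α k ≤ p) ∧
        ∀ k < n, ¬ ∃ h : k < m + 1, ∑ k ∈ Finset.Ioi ⟨k, h⟩, α k ≤ p :=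
      ⟨Nat.find hex, Nat.find_spec hex, fun k hk => Nat.find_min hex hk⟩
    refine ⟨⟨n, h⟩, hle, ?_⟩
    rcases n with _ | n
    · have h1 : (⟨0, by omega⟩ : Fin (m + 1)) = 0 := rfl
      rw [h1, Fin.sum_Ioi_zero, add_comm, ← Fin.sum_univ_succ]
      exact hp
    · by_contra! h2
      refine hmin n (by omega) ⟨by omega, ?_⟩
      rw [sum_Ioi_of_succ (k := ⟨n + 1, by omega⟩) rfl]
      exact h2

theorem row_unique {p : ℕ} {i k : Fin m} (hi : ∑ k ∈ Finset.Ioi i, α k ≤ p)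
    (hi' : p < ∑ k ∈ Finset.Ioi i, α k + α i) (hk : ∑ k ∈ Finset.Ioi k, α k ≤ p)
    (hk' : p < ∑ k ∈ Finset.Ioi k, α k + α k) : i = k := by
  rcases lt_trichotomy i k with h | h | h
  · have := sum_Ioi_add_le (f := α) h
    omega
  · exact h
  · have := sum_Ioi_add_le (f := α) h
    omega

/-- The row of the box at a given place of the word of a filling. -/
noncomputable def rowAt (p : Fin (∑ k, α k)) : Fin m :=
  (exists_row p.2).choose

theorem rowAt_spec (p : Fin (∑ k, α k)) : ∑ k ∈ Finset.Ioi (rowAt p), α k ≤ p ∧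
    p < ∑ k ∈ Finset.Ioi (rowAt p), α k + α (rowAt p) :=
  (exists_row p.2).choose_spec

theorem rowAt_eq {p : Fin (∑ k, α k)} {i : Fin m} (hi : ∑ k ∈ Finset.Ioi i, α k ≤ p)
    (hi' : p < ∑ k ∈ Finset.Ioi i, α k + α i) : rowAt p = i :=
  row_unique (rowAt_spec p).1 (rowAt_spec p).2 hi hi'

theorem place_lt (hα : ∀ i, 0 < α i) {i j : ℕ} (h : (i, j) ∈ (ribbon α).cells) :
    j + (m - 1 - i) < ∑ k, α k := by
  obtain ⟨hi, h1, h2⟩ := (mem_cells hα).1 h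
  have h3 := sum_Ioi_sub_one_add hα ⟨i, hi⟩
  have h4 := sum_Ioi_add_le_sum (f := α) ⟨i, hi⟩
  simp only at h3
  omega

/-- The boxes of a ribbon in the order of the rows from bottom to top, and from left to right in
each row. The box `(i, j)` has number `j + (m - 1 - i)`. -/
noncomputable def cellEquiv (hα : ∀ i, 0 < α i) : Fin (∑ k, α k) ≃ (ribbon α).cells where
  toFun p := ⟨(rowAt p, p - (m - 1 - rowAt p)), (mem_cells hα).2 ⟨(rowAt p).2, by
    have h1 := rowAt_spec p
    have h2 := sum_Ioi_sub_one_add hα (rowAt p)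
    simp only [Fin.eta]
    omega⟩⟩
  invFun c := ⟨c.1.2 + (m - 1 - c.1.1), place_lt hα c.2⟩
  left_inv p := by
    have h1 := rowAt_spec p
    have h2 := sum_Ioi_sub_one_add hα (rowAt p)
    apply Fin.ext
    simp only
    omega
  right_inv := by
    rintro ⟨⟨i, j⟩, hc⟩
    obtain ⟨hi, h1, h2⟩ := (mem_cells hα).1 hc
    have h3 := sum_Ioi_sub_one_add hα ⟨i, hi⟩
    have h4 : rowAt ⟨j + (m - 1 - i), place_lt hα hc⟩ = ⟨i, hi⟩ := by
      apply rowAt_eq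
      · simp only at h3 ⊢
        omega
      · simp only at h3 ⊢
        omega
    simp only at h3
    apply Subtype.ext
    simp only [h4]
    rw [Nat.add_sub_cancel]

theorem cellEquiv_apply (hα : ∀ i, 0 < α i) (p : Fin (∑ k, α k)) {i j : ℕ}
    (hc : (i, j) ∈ (ribbon α).cells) (h : p = j + (m - 1 - i)) :
    (cellEquiv hα p : ℕ × ℕ) = (i, j) := by
  have h1 : p = (cellEquiv hα).symm ⟨(i, j), hc⟩ := Fin.ext h
  rw [h1, Equiv.apply_symm_apply]

/-- The next box is to the right of a box in the same row, or, at the descents, above it. -/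
theorem cellEquiv_succ (hα : ∀ i, 0 < α i) {p : ℕ} (hp : p + 1 < ∑ k, α k) :
    (p ∈ ribbonDescents (List.ofFn α) ∧ ∃ i j, (i, j) ∈ (ribbon α).cells ∧
      (i + 1, j) ∈ (ribbon α).cells ∧ (cellEquiv hα ⟨p + 1, hp⟩ : ℕ × ℕ) = (i, j) ∧
      (cellEquiv hα ⟨p, by omega⟩ : ℕ × ℕ) = (i + 1, j)) ∨
    (p ∉ ribbonDescents (List.ofFn α) ∧ ∃ i j, (i, j) ∈ (ribbon α).cells ∧
      (i, j + 1) ∈ (ribbon α).cells ∧ (cellEquiv hα ⟨p + 1, hp⟩ : ℕ × ℕ) = (i, j + 1) ∧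
      (cellEquiv hα ⟨p, by omega⟩ : ℕ × ℕ) = (i, j)) := by
  rw [mem_ribbonDescents_ofFn]
  by_cases hd : ∃ i, ∑ k ∈ Finset.Ioi i, α k = p + 1
  · left
    refine ⟨hd, ?_⟩
    obtain ⟨i, hi⟩ := hd
    have hi1 : (i : ℕ) + 1 < m := by
      by_contra! h
      rw [Finset.sum_eq_zero] at hi
      · omega
      · intro k hk
        have := Fin.lt_def.1 (Finset.mem_Ioi.1 hk)
        omega
    have e1 := sum_Ioi_of_succ (f := α) (i := i) (k := ⟨i + 1, hi1⟩) rfl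
    have e2 := sum_Ioi_of_succ (f := fun k => α k - 1) (i := i) (k := ⟨i + 1, hi1⟩) rfl
    have e3 := sum_Ioi_sub_one_add hα i
    have h1 := hα i
    have h2 := hα ⟨i + 1, hi1⟩
    have c1 : ((i : ℕ), ∑ k ∈ Finset.Ioi i, (α k - 1)) ∈ (ribbon α).cells :=
      (mem_cells hα).2 ⟨i.2, by simp only [Fin.eta]; omega⟩
    have c2 : ((i : ℕ) + 1, ∑ k ∈ Finset.Ioi i, (α k - 1)) ∈ (ribbon α).cells :=
      (mem_cells hα).2 ⟨hi1, by omega⟩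
    exact ⟨i, _, c1, c2, cellEquiv_apply hα _ c1 (by simp only; omega),
      cellEquiv_apply hα _ c2 (by simp only; omega)⟩
  · right
    refine ⟨hd, ?_⟩
    obtain ⟨i, h1, h2⟩ := exists_row (p := p) (α := α) (by omega)
    have h3 : p + 1 < ∑ k ∈ Finset.Ioi i, α k + α i := by
      by_contra! h
      rcases Nat.eq_zero_or_pos (i : ℕ) with h0 | h0
      · have h4 := sum_Ici α i
        have h5 : Finset.Ici i = Finset.univ := by
          ext k
          simp [Fin.le_def, h0]
        rw [h5] at h4
        omega
      · refine hd ⟨⟨i - 1, by omega⟩, ?_⟩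
        rw [sum_Ioi_of_succ (k := i) (by simp only; omega)]
        omega
    have e3 := sum_Ioi_sub_one_add hα i
    have c1 : ((i : ℕ), p - (m - 1 - i)) ∈ (ribbon α).cells :=
      (mem_cells hα).2 ⟨i.2, by simp only [Fin.eta]; omega⟩
    have c2 : ((i : ℕ), p - (m - 1 - i) + 1) ∈ (ribbon α).cells :=
      (mem_cells hα).2 ⟨i.2, by simp only [Fin.eta]; omega⟩
    exact ⟨i, _, c1, c2, cellEquiv_apply hα _ c2 (by simp only; omega),
      cellEquiv_apply hα _ c1 (by simp only; omega)⟩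

theorem le_of_hasDescents {w : Fin (∑ k, α k) → ℕ}
    (hw : HasDescents (ribbonDescents (List.ofFn α)) w) {i : Fin m} {p t : ℕ}
    (h1 : ∑ k ∈ Finset.Ioi i, α k ≤ p) (h2 : p + t < ∑ k ∈ Finset.Ioi i, α k + α i)
    (h3 : p + t < ∑ k, α k) : w ⟨p, by omega⟩ ≤ w ⟨p + t, h3⟩ := by
  induction t with
  | zero => exact le_rfl
  | succ t ih =>
    refine (ih (by omega) (by omega)).trans (not_lt.1 ((hw (p + t) h3).not.2 ?_))
    rw [mem_ribbonDescents_ofFn]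
    rintro ⟨k, hk⟩
    rcases lt_or_ge k i with h | h
    · have := sum_Ioi_add_le (f := α) h
      omega
    · have : ∑ x ∈ Finset.Ioi k, α x ≤ ∑ x ∈ Finset.Ioi i, α x :=
        Finset.sum_le_sum_of_subset (Finset.Ioi_subset_Ioi h)
      omega

/-- A row between the two would have length at least two and push the lower one strictly to the
left. Hence column strictness concerns only the boxes at a descent of the reading word. -/
theorem eq_succ_of_same_column (hα : ∀ i, 2 ≤ α i) {i₁ i₂ j : ℕ} (hi : i₁ < i₂)
    (h1 : (i₁, j) ∈ (ribbon α).cells) (h2 : (i₂, j) ∈ (ribbon α).cells) :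
    i₂ = i₁ + 1 ∧ j + (m - 1 - i₂) ∈ ribbonDescents (List.ofFn α) ∧
      j + (m - 1 - i₁) = j + (m - 1 - i₂) + 1 := by
  have hα' : ∀ i, 0 < α i := fun i => by have := hα i; omega
  obtain ⟨hm1, h1, _⟩ := (mem_cells hα').1 h1
  obtain ⟨hm2, _, h2⟩ := (mem_cells hα').1 h2
  have e := sum_Ioi_of_succ (f := fun k => α k - 1) (i := ⟨i₁, hm1⟩) (k := ⟨i₁ + 1, by omega⟩) rfl
  have h3 := hα ⟨i₁ + 1, by omega⟩
  have h4 := hα ⟨i₂, hm2⟩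
  have h5 : i₂ = i₁ + 1 := by
    by_contra hne
    have := sum_Ioi_add_le (f := fun k => α k - 1) (i := ⟨i₁ + 1, by omega⟩) (k := ⟨i₂, hm2⟩)
      (Fin.mk_lt_mk.2 (by omega))
    omega
  subst h5
  refine ⟨rfl, mem_ribbonDescents_ofFn.2 ⟨⟨i₁, hm1⟩, ?_⟩, by omega⟩
  have h6 := sum_Ioi_sub_one_add hα' ⟨i₁, hm1⟩
  simp only at h6
  omega

/-- The fillings of a ribbon as words. -/
noncomputable def fillingEquiv (hα : ∀ i, 2 ≤ α i) :
    SkewSSYT (ribbon α) ≃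
      {w : Fin (∑ k, α k) → ℕ // HasDescents (ribbonDescents (List.ofFn α)) w} :=
  have hα' : ∀ i, 0 < α i := fun i => Nat.lt_of_lt_of_le Nat.zero_lt_two (hα i)
  { toFun := fun T => ⟨fun p => T.entry (cellEquiv hα' p).1.1 (cellEquiv hα' p).1.2, by
      intro p hp
      dsimp only
      rcases cellEquiv_succ hα' hp with ⟨hd, i, j, c1, c2, e1, e2⟩ | ⟨hd, i, j, c1, c2, e1, e2⟩
      · rw [e1, e2]
        exact iff_of_true (T.col_strict (Nat.lt_succ_self i) c1 c2) hd
      · rw [e1, e2]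
        exact iff_of_false (not_lt.2 (T.row_weak (Nat.lt_succ_self j) c1 c2)) hd⟩
    invFun := fun w =>
      { entry := fun i j => if h : (i, j) ∈ (ribbon α).cells then
          w.1 ⟨j + (m - 1 - i), place_lt hα' h⟩ else 0
        row_weak := by
          intro i j₁ j₂ hj h1 h2
          rw [dif_pos h1, dif_pos h2]
          obtain ⟨hi, h3, h4⟩ := (mem_cells hα').1 h1
          obtain ⟨_, h5, h6⟩ := (mem_cells hα').1 h2
          have h7 := sum_Ioi_sub_one_add hα' ⟨i, hi⟩
          have h8 := place_lt hα' h2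
          simp only at h7
          have h9 := le_of_hasDescents w.2 (i := ⟨i, hi⟩) (p := j₁ + (m - 1 - i)) (t := j₂ - j₁)
            (by omega) (by omega) (by omega)
          refine h9.trans (le_of_eq (congrArg w.1 (Fin.ext ?_)))
          simp only
          omega
        col_strict := by
          intro i₁ i₂ j hi h1 h2
          rw [dif_pos h1, dif_pos h2]
          obtain ⟨-, h3, h4⟩ := eq_succ_of_same_column hα hi h1 h2
          have h5 := (w.2 _ (h4 ▸ place_lt hα' h1)).2 h3
          simpa only [h4] using h5
        zeros := fun h => dif_neg h }
    left_inv := by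
      intro T
      apply SkewSSYT.ext_entry
      funext i j
      by_cases hc : (i, j) ∈ (ribbon α).cells
      · simp only [dif_pos hc]
        rw [cellEquiv_apply hα' _ hc rfl]
      · simp only [dif_neg hc]
        exact (T.zeros hc).symm
    right_inv := by
      rintro ⟨w, hw⟩
      apply Subtype.ext
      funext p
      have h := (cellEquiv hα' p).2
      simp only [Prod.mk.eta]
      rw [dif_pos h]
      congr 1
      exact (cellEquiv hα').symm_apply_apply p }

theorem skewSchurFunction_eq (hα : ∀ i, 2 ≤ α i) : skewSchurFunction (ribbon α) =
    wordSeries (List.ofFn α).sum (ribbonDescents (List.ofFn α)) := by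
  have h : skewSchurFunction (ribbon α) =
      generatingSeries fun T : SkewSSYT (ribbon α) => T.content := rfl
  rw [h, List.sum_ofFn, wordSeries]
  refine generatingSeries_congr (fillingEquiv hα) fun T => ?_
  have h1 := Finset.sum_coe_sort (ribbon α).cells fun c => Finsupp.single (T.entry c.1 c.2) 1
  rw [SkewSSYT.content, ← h1]
  exact (cellEquiv _).sum_comp fun c : (ribbon α).cells => Finsupp.single (T.entry c.1.1 c.1.2) 1

end ribbon

/-! ### The Schur expansion of a ribbon -/

theorem schurFunction_bot : schurFunction ⊥ = 1 := by
  classical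
  ext d
  rw [coeff_schurFunction, coeff_one]
  have hc : ∀ T : SemistandardYoungTableau ⊥, T.content = 0 := fun T => by
    simp [SemistandardYoungTableau.content]
  split_ifs with hd
  · rw [Nat.card_eq_one_iff_unique.2 ⟨⟨?_⟩, ⟨⟨default, (hc _).trans hd.symm⟩⟩⟩, Nat.cast_one]
    rintro ⟨T, hT⟩ ⟨T', hT'⟩
    apply Subtype.ext
    ext i j
    rw [T.zeros (YoungDiagram.notMem_bot _), T'.zeros (YoungDiagram.notMem_bot _)]
  · rw [Nat.card_eq_zero.2 (Or.inl ⟨?_⟩), Nat.cast_zero]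
    rintro ⟨T, hT⟩
    exact hd (hT.symm.trans (hc T))

theorem completeSymmetric_mul_sum (N a : ℕ) (c : YoungDiagram → ℤ) :
    completeSymmetric a * ∑ ν ∈ ofCard N, c ν • schurFunction ν =
      ∑ ν ∈ ofCard (N + a), (∑ μ ∈ removeStrip ν a, c μ) • schurFunction ν := by
  rw [Finset.mul_sum]
  simp only [mul_smul_comm, completeSymmetric_mul_schurFunction, Finset.smul_sum, Finset.sum_smul]
  refine Finset.sum_comm' fun μ ν => ?_
  simp only [mem_ofCard, mem_addStrip, mem_removeStrip]
  constructor
  · rintro ⟨h1, h2, h3⟩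
    exact ⟨⟨h2, h3.symm⟩, by omega⟩
  · rintro ⟨⟨h1, h2⟩, h3⟩
    exact ⟨by omega, h1, h2.symm⟩

/-- The top row is read last. Appending a weakly increasing word adds a new top row if there is a
descent at the junction, and lengthens the old top row otherwise; `ribbonDescents` ignores the head
of the list, so the latter changes no descent. -/
theorem wordSeries_ribbonDescents {a b : ℕ} (ha : 0 < a) (hb : 0 < b) (β : List ℕ) :
    completeSymmetric a * wordSeries (b :: β).sum (ribbonDescents (b :: β)) =
      wordSeries (a :: b :: β).sum (ribbonDescents (a :: b :: β)) +
        wordSeries ((a + b) :: β).sum (ribbonDescents ((a + b) :: β)) := by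
  obtain ⟨N, hN⟩ : ∃ N, (b :: β).sum = N + 1 := ⟨b + β.sum - 1, by rw [List.sum_cons]; omega⟩
  obtain ⟨a, rfl⟩ : ∃ a', a = a' + 1 := ⟨a - 1, by omega⟩
  have hD : ∀ p ∈ ribbonDescents (b :: β), p < N := fun p hp => by
    have := ribbonDescents_lt hp
    rw [List.tail_cons] at this
    rw [List.sum_cons] at hN
    omega
  have e1 : ((a + 1) :: b :: β).sum = N + 1 + (a + 1) := by rw [List.sum_cons, hN, add_comm]
  have e2 : ((a + 1 + b) :: β).sum = N + 1 + (a + 1) := by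
    rw [← e1, List.sum_cons, List.sum_cons, List.sum_cons, add_assoc]
  have e3 : ribbonDescents ((a + 1) :: b :: β) = insert N (ribbonDescents (b :: β)) := by
    ext p
    rw [ribbonDescents, hN, Set.mem_union, Set.mem_insert_iff, Set.mem_ofPred_eq,
      Nat.add_right_cancel_iff]
  have e4 : ribbonDescents ((a + 1 + b) :: β) = ribbonDescents (b :: β) := rfl
  rw [e1, e2, e3, e4, hN, mul_comm, wordSeries_mul_completeSymmetric hD]

theorem completeSymmetric_zero : completeSymmetric 0 = 1 := by
  classical
  ext d
  rw [coeff_completeSymmetric, coeff_one]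
  exact if_congr (Finsupp.degree_eq_zero_iff d) rfl rfl

theorem sum_ribbonCoeff_nil :
    ∑ ν ∈ ofCard 0, (ribbonCoeff [] ν : ℤ) • schurFunction ν = 1 := by
  rw [Finset.sum_eq_single ⊥]
  · rw [ribbonCoeff, if_pos rfl, Nat.cast_one, one_smul, schurFunction_bot]
  · intro ν _ hν
    rw [ribbonCoeff, if_neg hν, Nat.cast_zero, zero_smul]
  · intro h
    exact absurd (mem_ofCard.2 rfl) h

/-- The Schur expansion of a ribbon Schur function. -/
theorem wordSeries_eq_sum (n : ℕ) (β : List ℕ) (hn : β.length = n) (hβ : ∀ x ∈ β, 0 < x) :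
    wordSeries β.sum (ribbonDescents β) =
      ∑ ν ∈ ofCard β.sum, (ribbonCoeff β ν : ℤ) • schurFunction ν := by
  induction n generalizing β with
  | zero =>
    obtain rfl := List.length_eq_zero_iff.1 hn
    rw [List.sum_nil, sum_ribbonCoeff_nil, ← completeSymmetric_zero]
    exact wordSeries_empty 0
  | succ n ih =>
    match β, hn with
    | [a], _ =>
      have h1 := completeSymmetric_mul_sum 0 a fun ν => (ribbonCoeff [] ν : ℤ)
      have h2 : ribbonDescents [a] = ∅ := by
        ext p
        simp [ribbonDescents]
      rw [sum_ribbonCoeff_nil, mul_one, zero_add] at h1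
      rw [h2, List.sum_singleton, wordSeries_empty, h1]
      refine Finset.sum_congr rfl fun ν _ => ?_
      rw [← Nat.cast_sum]
      rfl
    | a :: b :: β, hn =>
      have ha := hβ a (by simp)
      have hb := hβ b (by simp)
      have h1 := ih (b :: β) (by simpa using hn) fun x hx => hβ x (by simp [hx])
      have h2 := ih ((a + b) :: β) (by simpa using hn) fun x hx => by
        rcases List.mem_cons.1 hx with rfl | hx
        · omega
        · exact hβ x (by simp [hx])
      -- The ribbon with n + 1 rows is a product minus a ribbon, and both ribbons involved have n
      -- rows. The coefficients satisfy the same recurrence.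
      rw [eq_sub_of_add_eq (wordSeries_ribbonDescents ha hb β).symm, h1, h2,
        completeSymmetric_mul_sum]
      have e1 : (b :: β).sum + a = (a :: b :: β).sum := by simp [add_comm]
      have e2 : ((a + b) :: β).sum = (a :: b :: β).sum := by simp [add_assoc]
      rw [e1, e2, ← Finset.sum_sub_distrib]
      refine Finset.sum_congr rfl fun ν _ => ?_
      rw [← sub_smul]
      congr 1
      have h3 := sum_ribbonCoeff_removeStrip (a := a) hb β ν
      zify at h3
      rw [h3, add_sub_cancel_right]

/-! ### Linear independence of Schur functions -/

theorem degree_filter_content {ν : YoungDiagram} (T : SemistandardYoungTableau ν) (k : ℕ) :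
    (Finsupp.filter (k ≤ ·) T.content).degree =
      (ν.cells.filter fun c => k ≤ T c.1 c.2).card := by
  have h : Finsupp.filter (k ≤ ·) T.content =
      ∑ c ∈ ν.cells, Finsupp.filter (k ≤ ·) (Finsupp.single (T c.1 c.2) 1) :=
    map_sum (Finsupp.filterAddHom (M := ℕ) (k ≤ ·)) _ _
  rw [h, map_sum, Finset.card_filter]
  refine Finset.sum_congr rfl fun c _ => ?_
  split_ifs with hc
  · rw [Finsupp.filter_single_of_pos _ hc, Finsupp.degree_single]
  · rw [Finsupp.filter_single_of_neg _ hc, map_zero]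

theorem SemistandardYoungTableau.le_entry {ν : YoungDiagram} (T : SemistandardYoungTableau ν)
    {i j : ℕ} (h : (i, j) ∈ ν) : i ≤ T i j := by
  induction i with
  | zero => exact Nat.zero_le _
  | succ i ih =>
    exact (ih (ν.up_left_mem (Nat.le_succ i) le_rfl h)).trans_lt (T.col_strict (Nat.lt_succ_self i) h)

theorem degree_filter_content_le {ν : YoungDiagram} (T : SemistandardYoungTableau ν) (k : ℕ) :
    ν.tail k ≤ (Finsupp.filter (k ≤ ·) T.content).degree := by
  rw [degree_filter_content]
  refine Finset.card_le_card fun c hc => ?_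
  rw [Finset.mem_filter] at hc ⊢
  exact ⟨hc.1, hc.2.trans (T.le_entry hc.1)⟩

theorem highestWeight_degree_filter (ν : YoungDiagram) (k : ℕ) :
    (Finsupp.filter (k ≤ ·) (SemistandardYoungTableau.highestWeight ν).content).degree =
      ν.tail k := by
  rw [degree_filter_content, tail]
  congr 1
  refine Finset.filter_congr fun c hc => ?_
  rw [SemistandardYoungTableau.highestWeight_apply, if_pos (show (c.1, c.2) ∈ ν from hc)]

/-- Triangularity in dominance order: s_ν contains the highest weight monomial of ρ only if the
tails of ν are at most those of ρ. For a ρ in the support with minimal tails, only ρ itself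
contributes to that coefficient. -/
theorem schurFunction_linearIndependent {c : YoungDiagram →₀ ℤ}
    (h : c.sum (fun ν a => a • schurFunction ν) = 0) : c = 0 := by
  by_contra hne
  obtain ⟨ρ, hρ⟩ := c.support.exists_minimalFor tail (Finsupp.support_nonempty_iff.2 hne)
  have h1 := congrArg (coeff (SemistandardYoungTableau.highestWeight ρ).content) h
  rw [Finsupp.sum, map_sum, map_zero, Finset.sum_eq_single_of_mem ρ hρ.1] at h1
  · rw [map_zsmul, smul_eq_mul, coeff_schurFunction, mul_eq_zero] at h1
    rcases h1 with h1 | h1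
    · exact Finsupp.mem_support_iff.1 hρ.1 h1
    · have := (SemistandardYoungTableau.finite_content_eq ρ
        (SemistandardYoungTableau.highestWeight ρ).content).to_subtype
      rw [Nat.cast_eq_zero, Nat.card_eq_zero] at h1
      rcases h1 with h1 | h1
      · exact h1.elim ⟨_, rfl⟩
      · exact h1.not_finite this
  · intro ν hν hνρ
    rw [map_zsmul, smul_eq_mul, coeff_schurFunction, Nat.card_eq_zero.2 (Or.inl ⟨?_⟩), Nat.cast_zero, mul_zero]
    rintro ⟨T, hT⟩
    have h2 : ν.tail ≤ ρ.tail := fun k => by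
      have := degree_filter_content_le T k
      rwa [hT, highestWeight_degree_filter] at this
    have h3 := le_antisymm h2 (hρ.2 hν h2)
    refine hνρ (ext_rowLen fun i => ?_)
    have h4 := ν.tail_succ i
    have h5 := ρ.tail_succ i
    rw [h3] at h4
    omega

theorem isSchurExpansion_unique {s : SkewShape} {c c' : YoungDiagram →₀ ℤ}
    (h : IsSchurExpansion s c) (h' : IsSchurExpansion s c') : c = c' := by
  refine sub_eq_zero.1 (schurFunction_linearIndependent ?_)
  rw [Finsupp.sum_sub_index fun ν a b => sub_smul a b _]
  exact sub_eq_zero.2 (h.symm.trans h')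

/-! ### The support of a ribbon and the conclusion -/

theorem mem_schurSupport_ribbon {m : ℕ} {α : Fin m → ℕ} (hm : 0 < m) (hα : ∀ i, 2 ≤ α i)
    (htri : IsTriangular (List.ofFn α : Multiset ℕ)) {ν : YoungDiagram} :
    ν ∈ schurSupport (ribbon α) ↔ Admissible (List.ofFn α : Multiset ℕ) ν := by
  classical
  have h2 : ∀ x ∈ List.ofFn α, 2 ≤ x := by
    intro x hx
    obtain ⟨i, rfl⟩ := (List.mem_ofFn' α x).1 hx
    exact hα i
  have hpos := ribbonCoeff_pos_iff (α := List.ofFn α) (by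
    rw [Ne, List.ofFn_eq_nil_iff]
    omega) h2 htri (ν := ν)
  obtain ⟨c, hc⟩ : ∃ c : YoungDiagram →₀ ℤ, c = Finsupp.indicator (ofCard (List.ofFn α).sum)
    fun ν _ => (ribbonCoeff (List.ofFn α) ν : ℤ) := ⟨_, rfl⟩
  have hexp : IsSchurExpansion (ribbon α) c := by
    rw [IsSchurExpansion, ribbon.skewSchurFunction_eq hα, wordSeries_eq_sum _ _ rfl
      fun x hx => by have := h2 x hx; omega]
    rw [hc, Finsupp.sum_of_support_subset _ (Finsupp.support_indicator_subset _ _)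
      (fun ν a => a • schurFunction ν) fun _ _ => zero_smul _ _]
    refine Finset.sum_congr rfl fun ν hν => ?_
    rw [Finsupp.indicator_of_mem hν]
  have hcν : 0 < c ν ↔ Admissible (List.ofFn α : Multiset ℕ) ν := by
    rw [← hpos, hc]
    by_cases hν : ν ∈ ofCard (List.ofFn α).sum
    · rw [Finsupp.indicator_of_mem hν]
      exact Nat.cast_pos
    · rw [Finsupp.indicator_of_notMem hν]
      refine iff_of_false (lt_irrefl _) fun h => hν ?_
      rw [mem_ofCard, (hpos.1 h).card_eq, Multiset.sum_coe]
  rw [← hcν]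
  constructor
  · rintro ⟨c', h1, h3⟩
    rwa [isSchurExpansion_unique hexp h1]
  · exact fun h => ⟨c, hexp, h⟩

theorem coe_ofFn_permuteRows {m : ℕ} (α : Fin m → ℕ) (π : Equiv.Perm (Fin m)) :
    (List.ofFn (permuteRows α π) : Multiset ℕ) = List.ofFn α :=
  Multiset.coe_eq_coe.2 (Equiv.Perm.ofFn_comp_perm π⁻¹ α)

/-- Peeling off one index at a time makes the three positions distinct even when lengths repeat. If
z is not the largest of the three, the inequality is clear because the lengths are positive. -/
theorem isTriangular_ofFn {m : ℕ} {α : Fin m → ℕ}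
    (htri : ∀ i j k : Fin m, i ≠ j → i ≠ k → j ≠ k → α i ≤ α j → α j ≤ α k → α k < α i + α j)
    (hα : ∀ i, 2 ≤ α i) : IsTriangular (List.ofFn α : Multiset ℕ) := by
  intro x y z h
  have key : ∀ (s : Finset (Fin m)) (x : ℕ) (t : Multiset ℕ), x ::ₘ t ≤ s.val.map α →
      ∃ i ∈ s, α i = x ∧ t ≤ (s.erase i).val.map α := by
    intro s x t h
    obtain ⟨i, hi, rfl⟩ := Multiset.mem_map.1 (Multiset.mem_of_le h (Multiset.mem_cons_self x t))
    refine ⟨i, hi, rfl, ?_⟩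
    rwa [← Multiset.cons_erase hi, Multiset.map_cons, Multiset.cons_le_cons_iff,
      ← Finset.erase_val] at h
  have h0 : (List.ofFn α : Multiset ℕ) = (Finset.univ : Finset (Fin m)).val.map α := by
    rw [List.ofFn_eq_map, ← Multiset.map_coe]
    rfl
  rw [h0] at h
  obtain ⟨i, -, rfl, h1⟩ := key _ _ _ h
  obtain ⟨j, hj, rfl, h2⟩ := key _ _ _ h1
  obtain ⟨k, hk, rfl, -⟩ := key _ z 0 h2
  have hji := Finset.ne_of_mem_erase hj
  have hkj := Finset.ne_of_mem_erase hk
  have hki := Finset.ne_of_mem_erase (Finset.mem_of_mem_erase hk)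
  have hi := hα i
  have hj := hα j
  rcases le_total (α i) (α j) with hij | hij
  · rcases le_total (α j) (α k) with hjk | hjk
    · exact htri i j k hji.symm hki.symm hkj.symm hij hjk
    · omega
  · rcases le_total (α i) (α k) with hik | hik
    · have := htri j i k hji hkj.symm hki.symm hij hik
      omega
    · omega

/-- A ribbon with at least three rows, all of length at least two, such that any three of its rows
(at distinct positions, lengths may repeat) have lengths satisfying the strict triangle inequality,
has full equivalence class. -/
theorem corollary3p4 (m : ℕ) (hm : 3 ≤ m) (α : Fin m → ℕ) (hα : ∀ i, 2 ≤ α i)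
    (htri : ∀ i j k : Fin m, i ≠ j → i ≠ k → j ≠ k → α i ≤ α j → α j ≤ α k → α k < α i + α j) :
    HasFullEquivalenceClass α := by
  intro π
  have h := isTriangular_ofFn htri hα
  ext ν
  rw [mem_schurSupport_ribbon (by omega) hα h,
    mem_schurSupport_ribbon (α := permuteRows α π) (by omega) (fun i => hα _) (by rwa [coe_ofFn_permuteRows]),
    coe_ofFn_permuteRows]
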